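/- An instance consists of $n$ tasks, given by non-empty intervals $[s_i,e_i)\subseteq(-1,1)$ with rational endpoints, $e_i\in(0,1]$ and $e_i-s_i\le 1$, and of a positive integer $q$, the number of workers. The $r$th occurrence of task $i$ ($r\in\mathbb{Z}_{>0}$) takes place over $[s_i+r,e_i+r)$. An assignment is a function $f\colon[n]\times\mathbb{Z}_{>0}\to[q]$. It is feasible if, for all $i\ne i'$ and all $r,r'$, $[s_i+r,e_i+r)\cap[s_{i'}+r',e_{i'}+r')\neq\varnothing$ implies $f(i,r)\neq f(i',r')$. It is balanced if $\lim_{t\to\infty}\frac1t|\{r\in[t]\colon f(i,r)=j\}|=\frac1q$ for all $i\in[n]$, $j\in[q]$. It is periodic with period $h$ if $f(i,r)=f(i,r+h)$ for all $i,r$. Instances are encoded in binary (the number $n$, the number $q$, and the numerators and denominators of the endpoints), and polynomial time means polynomial in the size of the encoding, on a random access machine with logarithmic cost. Then: (1) Deciding, given an instance, whether a balanced feasible assignment exists can be done in polynomial time. (2) There is a polynomial-time algorithm that, given an instance for which a balanced feasible assignment exists, computes a description $d$ of a balanced feasible assignment $g$ that is periodic with period $q$. The size of $d$ is bounded by a polynomial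 in $n$ alone (independent of $q$), and a fixed algorithm computes $g(i,r)$ from $q$, $i$, $r$ (in binary) and $d$ in time polynomial in the size of $(q,i,r,d)$. -/

import Mathlib

namespace BalancedTasks

/-! ### Random access machines with logarithmic cost -/

/-- Memory: finitely many integer arrays are used by a program; `m a k` is cell `k` of array `a`. -/
abbrev Mem : Type := ℕ → ℕ → ℤ

/-- Integer expressions; `cell a e` is the content of array `a` at the address given by `e`
(indirect addressing), `div` is the integer quotient. -/
inductive Expr : Type
  | const (c : ℤ)
  | cell (a : ℕ) (idx : Expr)
  | add (x y : Expr)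
  | sub (x y : Expr)
  | mul (x y : Expr)
  | div (x y : Expr)

/-- The value of an expression. -/
def Expr.eval (m : Mem) : Expr → ℤ
  | .const c => c
  | .cell a idx => m a (idx.eval m).toNat
  | .add x y => x.eval m + y.eval m
  | .sub x y => x.eval m - y.eval m
  | .mul x y => x.eval m * y.eval m
  | .div x y => x.eval m / y.eval m

/-- Size of an integer: one plus the number of binary digits of its absolute value. -/
def intSize (z : ℤ) : ℕ := 1 + z.natAbs.size

/-- Size of a list of integers in binary. -/
def dataSize (x : List ℤ) : ℕ := (x.map intSize).sum

/-- Logarithmic cost of evaluating an expression: every operand, every address and every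
(intermediate) result is charged its binary size. -/
def Expr.cost (m : Mem) : Expr → ℕ
  | .const c => intSize c
  | .cell a idx => idx.cost m + intSize (Expr.eval m (.cell a idx))
  | .add x y => x.cost m + y.cost m + intSize (Expr.eval m (.add x y))
  | .sub x y => x.cost m + y.cost m + intSize (Expr.eval m (.sub x y))
  | .mul x y => x.cost m + y.cost m + intSize (Expr.eval m (.mul x y))
  | .div x y => x.cost m + y.cost m + intSize (Expr.eval m (.div x y))

/-- Programs. Conditions test whether the value of an expression is positive. -/
inductive Prog : Type
  | skip
  | store (a : ℕ) (idx val : Expr)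
  | seq (c d : Prog)
  | ite (b : Expr) (c d : Prog)
  | loop (b : Expr) (c : Prog)

/-- `Exec c m t m'`: started in memory `m`, the program `c` halts in memory `m'`, at total
logarithmic cost `t`. -/
inductive Exec : Prog → Mem → ℕ → Mem → Prop
  | skip (m : Mem) : Exec .skip m 1 m
  | store (a : ℕ) (idx val : Expr) (m : Mem) :
      Exec (.store a idx val) m (1 + idx.cost m + val.cost m)
        (Function.update m a (Function.update (m a) (idx.eval m).toNat (val.eval m)))
  | seq {c d : Prog} {m₀ m₁ m₂ : Mem} {t u : ℕ} :
      Exec c m₀ t m₁ → Exec d m₁ u m₂ → Exec (.seq c d) m₀ (t + u) m₂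
  | ite_pos {b : Expr} {c d : Prog} {m m' : Mem} {t : ℕ} :
      0 < b.eval m → Exec c m t m' → Exec (.ite b c d) m (1 + b.cost m + t) m'
  | ite_neg {b : Expr} {c d : Prog} {m m' : Mem} {t : ℕ} :
      ¬ 0 < b.eval m → Exec d m t m' → Exec (.ite b c d) m (1 + b.cost m + t) m'
  | loop_done {b : Expr} {c : Prog} {m : Mem} :
      ¬ 0 < b.eval m → Exec (.loop b c) m (1 + b.cost m) m
  | loop_step {b : Expr} {c : Prog} {m₀ m₁ m₂ : Mem} {t u : ℕ} :
      0 < b.eval m₀ → Exec c m₀ t m₁ → Exec (.loop b c) m₁ u m₂ →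
      Exec (.loop b c) m₀ (1 + b.cost m₀ + t + u) m₂

/-- Initial memory: array `0` holds the input list, preceded by its length; the rest is zero. -/
def inputMem (x : List ℤ) : Mem :=
  fun a k => if a = 0 then ((x.length : ℤ) :: x).getD k 0 else 0

/-- Output convention: array `1` holds the output list, preceded by its length. -/
def IsOutput (m : Mem) (y : List ℤ) : Prop :=
  ∀ k ≤ y.length, m 1 k = ((y.length : ℤ) :: y).getD k 0

/-- On input `x`, the program `P` halts with output `y` at cost at most `t`. -/
def ComputesWithin (P : Prog) (x y : List ℤ) (t : ℕ) : Prop :=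
  ∃ u ≤ t, ∃ m, Exec P (inputMem x) u m ∧ IsOutput m y

/-- The decision problem `p`, on objects encoded by `enc`, is solvable in polynomial time. -/
def DecidableInPolyTime {α : Type} (enc : α → List ℤ) (p : α → Prop) : Prop :=
  ∃ (P : Prog) (T : Polynomial ℕ), ∀ a,
    (p a → ComputesWithin P (enc a) [1] (T.eval (dataSize (enc a)))) ∧
    (¬ p a → ComputesWithin P (enc a) [0] (T.eval (dataSize (enc a))))

/-! ### Periodic tasks and assignments -/

/-- An instance: `n` tasks with rational endpoints, given by intervals `[s i, e i) ⊆ (-1, 1)`, and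
a positive number `q` of workers. -/
structure TaskInstance : Type where
  n : ℕ
  q : ℕ
  s : Fin n → ℚ
  e : Fin n → ℚ
  q_pos : 0 < q
  neg_one_lt_s : ∀ i, -1 < s i
  s_lt_e : ∀ i, s i < e i
  e_pos : ∀ i, 0 < e i
  e_le_one : ∀ i, e i ≤ 1
  length_le_one : ∀ i, e i - s i ≤ 1

namespace TaskInstance

/-- The time interval of the `r`th occurrence of task `i`. -/
def occ (I : TaskInstance) (i : Fin I.n) (r : ℕ+) : Set ℝ :=
  Set.Ico ((I.s i : ℝ) + (r : ℕ)) ((I.e i : ℝ) + (r : ℕ))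

/-- `f i r` is the worker to whom the `r`th occurrence of task `i` is assigned. -/
abbrev Assignment (I : TaskInstance) : Type := Fin I.n → ℕ+ → Fin I.q

/-- The non-overlapping property. -/
def Feasible (I : TaskInstance) (f : I.Assignment) : Prop :=
  ∀ (i i' : Fin I.n) (r r' : ℕ+), i ≠ i' → (I.occ i r ∩ I.occ i' r').Nonempty → f i r ≠ f i' r'

/-- Every worker performs every task with long-term frequency `1 / q`. (The occurrences
`1, …, t` are `k + 1` for `k < t`.) -/
def Balanced (I : TaskInstance) (f : I.Assignment) : Prop :=
  ∀ (i : Fin I.n) (j : Fin I.q),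
    Filter.Tendsto
      (fun t : ℕ => (1 / (t : ℝ)) * (((Finset.range t).filter fun k => f i k.succPNat = j).card : ℝ))
      Filter.atTop (nhds (1 / (I.q : ℝ)))

/-- `h` is a period of the assignment `f`. -/
def HasPeriod (I : TaskInstance) (f : I.Assignment) (h : ℕ+) : Prop :=
  ∀ (i : Fin I.n) (r : ℕ+), f i r = f i (r + h)

/-- The encoding of an instance: `n`, `q`, and the numerators and denominators of all endpoints. -/
def encode (I : TaskInstance) : List ℤ :=
  (I.n : ℤ) :: (I.q : ℤ) ::
    (List.ofFn fun i => [(I.s i).num, ((I.s i).den : ℤ), (I.e i).num, ((I.e i).den : ℤ)]).flatten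

/-- The evaluator `E`, at cost bounded by the polynomial `T` in the size of its input, reads off the
assignment `f` from its description `d`: on input `q`, `i`, `r` (numbers in binary) and `d` it
returns `f i r`. Tasks and workers are numbered from `0`. -/
def Describes (I : TaskInstance) (E : Prog) (T : Polynomial ℕ) (d : List ℤ)
    (f : I.Assignment) : Prop :=
  ∀ (i : Fin I.n) (r : ℕ+),
    let x : List ℤ := (I.q : ℤ) :: ((i : ℕ) : ℤ) :: ((r : ℕ) : ℤ) :: d
    ComputesWithin E x [((f i r : ℕ) : ℤ)] (T.eval (dataSize x))

end TaskInstance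

end BalancedTasks

open BalancedTasks

/-! Time is first made discrete. The `n` tasks have `2 n` endpoints, and ranking a point of time
among all integer translates of these endpoints preserves every overlap. The tasks become integer
intervals that recur with period `M = 2 n`, that is, arcs on the circle of integers modulo `M`. Let
the load at `t` be the number of tasks covering `t`. If it never exceeds `q`, add `q - load t` idle
arcs from `t` to `t + 1` for every `t`. Every vertex then has as many incoming as outgoing arcs, and
the lengths of all arcs add up to `q * M`.

A balanced feasible assignment exists if and only if the load is at most `q` everywhere and all
tasks lie in one component of this graph. Necessity (`Schedule.load_le`,
`Schedule.tasks_connected`): simultaneous tasks have different workers, and a worker followed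
through time traverses successively adjacent arcs and, by balance, meets every task again and again.
Sufficiency (`IsArcs.not_dvd`): a closed walk through all tasks that uses no arc twice lays them out
as disjoint intervals on a circle of length `q * M`. If task `i` is placed at `S i + c i * M`, then
worker `c i - r` modulo `q` can take its `r`th occurrence. Such a cyclic assignment has period `q`
and is balanced whatever the offsets `c` are, so the list of offsets is the description.

The closed walk is a cycle of a permutation that sends each arc to a successor. The permutation is
built greedily (`exists_unmatched`), and cycles containing arcs with a common head are merged by
exchanging successors (`sameCycle_mul_swap`). The graph has `n + 2 n q` arcs, which is polynomial
only for small `q`; but for `q ≥ 2 n` the offsets `2 i` always work (`valid_two_mul`). In the other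
case `q < 2 n` also bounds the offsets by a polynomial in `n` alone.

For running times, the algorithms are written with bounded loops, so that final memory and number of
steps are plain functions. Products involve input cells only, hence each step lengthens numbers by a
bounded amount, and the logarithmic cost is quadratic in the number of steps (`exec_compile`). -/

namespace BalancedTasks

/-! ### A language of bounded loops -/

/-- Programs with bounded loops: `iter v h c` executes `c` for all values of the variable `v` below
the value of the variable `h` (a variable is cell `0` of an array). -/
inductive LProg : Type
  | skip
  | store (a : ℕ) (idx val : Expr)
  | seq (c d : LProg)
  | ite (b : Expr) (c d : LProg)
  | iter (v h : ℕ) (c : LProg)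

/-- The content of a variable. -/
abbrev Expr.var (v : ℕ) : Expr := .cell v (.const 0)

namespace LProg

/-- Assignment to a variable. -/
abbrev set (v : ℕ) (e : Expr) : LProg := .store v (.const 0) e

/-- Translation to programs of the random access machine. -/
def compile : LProg → Prog
  | .skip => .skip
  | .store a idx val => .store a idx val
  | .seq c d => .seq c.compile d.compile
  | .ite b c d => .ite b c.compile d.compile
  | .iter v h c => .seq (.store v (.const 0) (.const 0))
      (.loop (.sub (.var h) (.var v))
        (.seq c.compile (.store v (.const 0) (.add (.var v) (.const 1)))))

end LProg

/-- Memory after a store. -/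
def Mem.put (m : Mem) (a : ℕ) (k : ℕ) (z : ℤ) : Mem :=
  Function.update m a (Function.update (m a) k z)

theorem Mem.put_apply (m : Mem) (a k : ℕ) (z : ℤ) (b l : ℕ) :
    m.put a k z b l = if b = a ∧ l = k then z else m b l := by
  unfold Mem.put
  by_cases h : b = a
  · subst h; by_cases h' : l = k <;> simp [h']
  · simp [h]

theorem Mem.put_ne (m : Mem) {a b : ℕ} (k : ℕ) (z : ℤ) (h : b ≠ a) : m.put a k z b = m b := by
  simp [Mem.put, h]

/-! ### Denotation of programs with bounded loops -/

namespace LProg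

/-- The memory in which a program halts. -/
def den : LProg → Mem → Mem
  | .skip, m => m
  | .store a idx val, m => m.put a (idx.eval m).toNat (val.eval m)
  | .seq c d, m => d.den (c.den m)
  | .ite b c d, m => if 0 < b.eval m then c.den m else d.den m
  | .iter v h c, m =>
      (fun s => (c.den s).put v 0 (c.den s v 0 + 1))^[(m h 0).toNat] (m.put v 0 0)

/-- The number of elementary steps. -/
def steps : LProg → Mem → ℕ
  | .skip, _ => 1
  | .store _ _ _, _ => 1
  | .seq c d, m => c.steps m + d.steps (c.den m)
  | .ite b c d, m => 1 + if 0 < b.eval m then c.steps m else d.steps m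
  | .iter v h c, m => 2 + ∑ i ∈ Finset.range (m h 0).toNat,
      (2 + c.steps ((fun s => (c.den s).put v 0 (c.den s v 0 + 1))^[i] (m.put v 0 0)))

/-- The arrays that a program writes. -/
def writes : LProg → List ℕ
  | .skip => []
  | .store a _ _ => [a]
  | .seq c d => c.writes ++ d.writes
  | .ite _ c d => c.writes ++ d.writes
  | .iter v _ c => v :: c.writes

theorem den_frame (c : LProg) : ∀ (m : Mem) {a : ℕ}, a ∉ c.writes → c.den m a = m a := by
  induction c with
  | skip => intro m a _; rfl
  | store b idx val =>
    intro m a h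
    simp only [writes, List.mem_singleton] at h
    exact Mem.put_ne _ _ _ h
  | seq c d ihc ihd =>
    intro m a h
    simp only [writes, List.mem_append, not_or] at h
    rw [den, ihd _ h.2, ihc _ h.1]
  | ite b c d ihc ihd =>
    intro m a h
    simp only [writes, List.mem_append, not_or] at h
    rw [den]
    split
    · exact ihc _ h.1
    · exact ihd _ h.2
  | iter v h c ih =>
    intro m a ha
    simp only [writes, List.mem_cons, not_or] at ha
    rw [den]
    generalize (m h 0).toNat = k
    induction k with
    | zero => exact Mem.put_ne _ _ _ ha.1
    | succ k ihk =>
      rw [Function.iterate_succ_apply', Mem.put_ne _ _ _ ha.1, ih _ ha.2, ihk]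

/-- Induction rule for bounded loops. -/
theorem den_iter_induction {v h : ℕ} {c : LProg} {m : Mem} (hv : v ∉ c.writes)
    (k : ℕ) (hk : m h 0 = k) (I : ℕ → Mem → Prop) (h0 : I 0 (m.put v 0 0))
    (hs : ∀ i < k, ∀ s : Mem, I i s → s v 0 = i → (∀ a, a ∉ v :: c.writes → s a = m a) →
      I (i + 1) ((c.den s).put v 0 (i + 1))) :
    I k ((LProg.iter v h c).den m) := by
  rw [den, hk, Int.toNat_natCast]
  suffices H : ∀ i ≤ k, ∀ s, s = (fun s => (c.den s).put v 0 (c.den s v 0 + 1))^[i] (m.put v 0 0) →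
      I i s ∧ s v 0 = i ∧ ∀ a, a ∉ v :: c.writes → s a = m a from (H k le_rfl _ rfl).1
  intro i
  induction i with
  | zero =>
    rintro - s rfl
    refine ⟨h0, by simp [Mem.put_apply], fun a ha => ?_⟩
    simp only [List.mem_cons, not_or] at ha
    exact Mem.put_ne _ _ _ ha.1
  | succ i ih =>
    rintro hi s rfl
    obtain ⟨h1, h2, h3⟩ := ih (by omega) _ rfl
    rw [Function.iterate_succ_apply']
    generalize (fun s => (c.den s).put v 0 (c.den s v 0 + 1))^[i] (m.put v 0 0) = s at h1 h2 h3
    have h4 : c.den s v 0 = i := by rw [den_frame c s hv, h2]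
    simp only [h4]
    refine ⟨by exact_mod_cast hs i (by omega) s h1 h2 h3, by simp [Mem.put_apply], fun a ha => ?_⟩
    have ha' := ha
    simp only [List.mem_cons, not_or] at ha'
    rw [Mem.put_ne _ _ _ ha'.1, den_frame c s ha'.2, h3 a ha]

/-! ### Step bounds -/

/-- The variables that bound loops. -/
def bounds : LProg → List ℕ
  | .skip => []
  | .store _ _ _ => []
  | .seq c d => c.bounds ++ d.bounds
  | .ite _ c d => c.bounds ++ d.bounds
  | .iter _ h c => h :: c.bounds

/-- The length of a program. -/
def len : LProg → ℕ
  | .skip => 1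
  | .store _ _ _ => 1
  | .seq c d => c.len + d.len
  | .ite _ c d => 1 + c.len + d.len
  | .iter _ _ c => c.len + 4

/-- The nesting depth of the loops. -/
def depth : LProg → ℕ
  | .skip => 0
  | .store _ _ _ => 0
  | .seq c d => max c.depth d.depth
  | .ite _ c d => max c.depth d.depth
  | .iter _ _ c => c.depth + 1

/-- Loop bounds lie outside all written arrays, so they keep their initial values and every loop
runs at most `R` times; nesting multiplies these counts. Fixing one list `W` for all subprograms
ensures that an earlier part does not change a bound used later. -/
theorem steps_le (W : List ℕ) (R : ℕ) (c : LProg) : ∀ (m : Mem), (∀ a ∈ c.writes, a ∈ W) →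
    (∀ h ∈ c.bounds, h ∉ W ∧ (m h 0).toNat ≤ R) → c.steps m ≤ c.len * (R + 1) ^ c.depth := by
  have key : ∀ {d e : ℕ}, d ≤ e → (R + 1) ^ d ≤ (R + 1) ^ e := fun h =>
    Nat.pow_le_pow_right (by omega) h
  induction c with
  | skip => intro m _ _; simp [steps, len, depth]
  | store => intro m _ _; simp [steps, len, depth]
  | seq c d ihc ihd =>
    intro m hW hb
    simp only [writes, bounds, List.mem_append] at hW hb
    have h1 := ihc m (fun a ha => hW a (.inl ha)) (fun a ha => hb a (.inl ha))
    have h2 := ihd (c.den m) (fun a ha => hW a (.inr ha)) (fun h hh => by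
      have := hb h (.inr hh)
      rw [den_frame c m (fun hc => this.1 (hW _ (.inl hc)))]
      exact this)
    simp only [steps, len, depth, add_mul]
    exact add_le_add (h1.trans (Nat.mul_le_mul_left _ (key (le_max_left _ _))))
      (h2.trans (Nat.mul_le_mul_left _ (key (le_max_right _ _))))
  | ite b c d ihc ihd =>
    intro m hW hb
    simp only [writes, bounds, List.mem_append] at hW hb
    have h1 := ihc m (fun a ha => hW a (.inl ha)) (fun a ha => hb a (.inl ha))
    have h2 := ihd m (fun a ha => hW a (.inr ha)) (fun a ha => hb a (.inr ha))
    have h1' := h1.trans (Nat.mul_le_mul_left _ (key (le_max_left c.depth d.depth)))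
    have h2' := h2.trans (Nat.mul_le_mul_left _ (key (le_max_right c.depth d.depth)))
    have h3 : 1 ≤ (R + 1) ^ max c.depth d.depth := Nat.one_le_pow _ _ (by omega)
    simp only [steps, len, depth, add_mul, one_mul]
    split <;> omega
  | iter v h c ih =>
    intro m hW hb
    simp only [writes, bounds, List.mem_cons] at hW hb
    have hR := hb h (.inl rfl)
    have hsum : ∀ i ∈ Finset.range (m h 0).toNat,
        2 + c.steps ((fun s => (c.den s).put v 0 (c.den s v 0 + 1))^[i] (m.put v 0 0))
          ≤ 2 + c.len * (R + 1) ^ c.depth := by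
      intro i _
      refine Nat.add_le_add_left (ih _ (fun a ha => hW a (.inr ha)) fun h' hh' => ?_) 2
      have hh := hb h' (.inr hh')
      refine ⟨hh.1, ?_⟩
      have : (fun s => (c.den s).put v 0 (c.den s v 0 + 1))^[i] (m.put v 0 0) h' = m h' := by
        have hv : h' ≠ v := fun e => hh.1 (hW _ (.inl e))
        have hc : h' ∉ c.writes := fun e => hh.1 (hW _ (.inr e))
        induction i with
        | zero => exact Mem.put_ne _ _ _ hv
        | succ i ihi =>
          rw [Function.iterate_succ_apply', Mem.put_ne _ _ _ hv, den_frame c _ hc, ihi]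
          simp only [Finset.mem_range] at *; omega
      rw [this]; exact hh.2
    have h1 := Finset.sum_le_sum hsum
    rw [Finset.sum_const, Finset.card_range, smul_eq_mul] at h1
    have h2 : (m h 0).toNat * (2 + c.len * (R + 1) ^ c.depth)
        ≤ R * (2 + c.len * (R + 1) ^ c.depth) := Nat.mul_le_mul_right _ hR.2
    have h3 : 1 ≤ (R + 1) ^ c.depth := Nat.one_le_pow _ _ (by omega)
    simp only [steps, len, depth, pow_succ]
    nlinarith [Nat.zero_le (c.len * (R + 1) ^ c.depth), Nat.mul_le_mul_right (R + 1) h3,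
      Nat.mul_le_mul_left R h3]

end LProg

/-! ### Sizes of values and costs of expressions -/

/-- `e.tame ro`: products only involve cells of the (read-only) input array; with `ro` set, this
holds for the whole value of `e`. -/
def Expr.tame : Bool → Expr → Bool
  | _, .const _ => true
  | ro, .cell a idx => (!ro || a == 0) && idx.tame false
  | ro, .add x y => x.tame ro && y.tame ro
  | ro, .sub x y => x.tame ro && y.tame ro
  | _, .mul x y => x.tame true && y.tame true
  | ro, .div x y => x.tame ro && y.tame ro

/-- The weight of an expression. -/
def Expr.weight : Expr → ℕ
  | .const c => intSize c
  | .cell _ idx => idx.weight + 1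
  | .add x y => x.weight + y.weight + 1
  | .sub x y => x.weight + y.weight + 1
  | .mul x y => x.weight + y.weight + 1
  | .div x y => x.weight + y.weight + 1

/-- All values in memory have at most `B` binary digits, those of the input array at most `L`. -/
structure Mem.Small (m : Mem) (B L : ℕ) : Prop where
  all : ∀ a k, (m a k).natAbs.size ≤ B
  input : ∀ k, (m 0 k).natAbs.size ≤ L

theorem size_add_le {x y : ℤ} {b : ℕ} (hx : x.natAbs.size ≤ b) (hy : y.natAbs.size ≤ b) :
    (x + y).natAbs.size ≤ b + 1 := by
  rw [Nat.size_le] at *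
  have := Int.natAbs_add_le x y
  rw [pow_succ]; omega

theorem size_sub_le {x y : ℤ} {b : ℕ} (hx : x.natAbs.size ≤ b) (hy : y.natAbs.size ≤ b) :
    (x - y).natAbs.size ≤ b + 1 := by
  rw [sub_eq_add_neg]
  exact size_add_le hx (by rwa [Int.natAbs_neg])

theorem size_mul_le {x y : ℤ} {b c : ℕ} (hx : x.natAbs.size ≤ b) (hy : y.natAbs.size ≤ c) :
    (x * y).natAbs.size ≤ b + c := by
  rw [Nat.size_le] at *
  rw [Int.natAbs_mul, pow_add]
  exact Nat.mul_lt_mul'' hx hy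

theorem size_div_le {x : ℤ} {b : ℕ} (y : ℤ) (hx : x.natAbs.size ≤ b) :
    (x / y).natAbs.size ≤ b :=
  (Nat.size_le_size (Int.natAbs_ediv_le_natAbs x y)).trans hx

/-- Factors of a product are built from input cells and constants, so the size of the product is
controlled by `L` and stays below `B`. The other operations cost at most one extra bit per node.
This excludes growth by repeated squaring. -/
theorem Expr.size_eval_le {m : Mem} {B L : ℕ} (hm : m.Small B L) (e : Expr) :
    (e.tame true → (e.eval m).natAbs.size ≤ e.weight * (L + 1)) ∧
    (e.tame false → e.weight * (L + 1) ≤ B → (e.eval m).natAbs.size ≤ B + e.weight) := by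
  induction e with
  | const c =>
    simp only [Expr.eval, Expr.weight, intSize]
    exact ⟨fun _ => by nlinarith [Nat.zero_le (c.natAbs.size * L)], fun _ _ => by omega⟩
  | cell a idx ih =>
    refine ⟨fun h => ?_, fun _ _ => (hm.all _ _).trans (Nat.le_add_right _ _)⟩
    simp only [Expr.tame, Bool.not_true, Bool.false_or, Bool.and_eq_true, beq_iff_eq] at h
    obtain ⟨rfl, -⟩ := h
    refine (hm.input _).trans ?_
    simp only [Expr.weight]
    nlinarith [Nat.zero_le (idx.weight * (L + 1))]
  | add x y ihx ihy =>
    simp only [Expr.tame, Bool.and_eq_true, Expr.eval, Expr.weight, add_mul, one_mul]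
    refine ⟨fun h => ?_, fun h hB => ?_⟩
    · refine (size_add_le ((ihx.1 h.1).trans (Nat.le_add_right _ _))
        ((ihy.1 h.2).trans (Nat.le_add_left _ _))).trans (by omega)
    · refine (size_add_le (b := B + x.weight + y.weight) ((ihx.2 h.1 (by omega)).trans (by omega))
        ((ihy.2 h.2 (by omega)).trans (by omega))).trans (by omega)
  | sub x y ihx ihy =>
    simp only [Expr.tame, Bool.and_eq_true, Expr.eval, Expr.weight, add_mul, one_mul]
    refine ⟨fun h => ?_, fun h hB => ?_⟩
    · refine (size_sub_le ((ihx.1 h.1).trans (Nat.le_add_right _ _))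
        ((ihy.1 h.2).trans (Nat.le_add_left _ _))).trans (by omega)
    · refine (size_sub_le (b := B + x.weight + y.weight) ((ihx.2 h.1 (by omega)).trans (by omega))
        ((ihy.2 h.2 (by omega)).trans (by omega))).trans (by omega)
  | mul x y ihx ihy =>
    simp only [Expr.tame, Bool.and_eq_true, Expr.eval, Expr.weight, add_mul, one_mul]
    have H : x.tame true ∧ y.tame true → (x.eval m * y.eval m).natAbs.size ≤ _ := fun h =>
      size_mul_le (ihx.1 h.1) (ihy.1 h.2)
    exact ⟨fun h => (H h).trans (by omega), fun h hB => (H h).trans (by omega)⟩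
  | div x y ihx ihy =>
    simp only [Expr.tame, Bool.and_eq_true, Expr.eval, Expr.weight, add_mul, one_mul]
    exact ⟨fun h => (size_div_le _ (ihx.1 h.1)).trans (by omega),
      fun h hB => (size_div_le _ (ihx.2 h.1 (by omega))).trans (by omega)⟩

theorem Expr.tame_of_tame_true {e : Expr} (h : e.tame true) : e.tame false := by
  induction e <;> simp_all [Expr.tame]

theorem Expr.cost_le {m : Mem} {B L : ℕ} (hm : m.Small B L) (e : Expr) (h : e.tame false)
    {K : ℕ} (hK : e.weight ≤ K) (hB : K * (L + 1) ≤ B) :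
    e.cost m ≤ e.weight * (B + K + 1) := by
  have main : intSize (e.eval m) ≤ B + K + 1 := by
    have := (e.size_eval_le hm).2 h ((Nat.mul_le_mul_right _ hK).trans hB)
    unfold intSize; omega
  induction e with
  | const c =>
    simp only [Expr.cost, Expr.weight]
    nlinarith [Nat.zero_le (intSize c * (B + K))]
  | cell a idx ih =>
    simp only [Expr.tame, Bool.and_eq_true, Expr.weight] at h hK
    have h1 := ih h.2 (by omega) (by
      have := (idx.size_eval_le hm).2 h.2 ((Nat.mul_le_mul_right _ (by omega : _ ≤ K)).trans hB)
      unfold intSize; omega)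
    simp only [Expr.cost, Expr.weight, add_mul, one_mul]
    omega
  | add x y ihx ihy | sub x y ihx ihy | mul x y ihx ihy | div x y ihx ihy =>
    simp only [Expr.tame, Bool.and_eq_true, Expr.weight] at h hK
    have h' : x.tame false ∧ y.tame false := by
      first
        | exact h
        | exact ⟨tame_of_tame_true h.1, tame_of_tame_true h.2⟩
    have h1 := ihx h'.1 (by omega) (by
      have := (x.size_eval_le hm).2 h'.1 ((Nat.mul_le_mul_right _ (by omega : _ ≤ K)).trans hB)
      unfold intSize; omega)
    have h2 := ihy h'.2 (by omega) (by
      have := (y.size_eval_le hm).2 h'.2 ((Nat.mul_le_mul_right _ (by omega : _ ≤ K)).trans hB)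
      unfold intSize; omega)
    simp only [Expr.cost, Expr.weight, add_mul, one_mul]
    omega

/-! ### Logarithmic cost of translated programs -/

namespace LProg

/-- Well-formed programs: expressions are tame, the input array is not written, and loop variables
and loop bounds are not changed by the body of the loop. -/
def wf : LProg → Bool
  | .skip => true
  | .store a idx val => a != 0 && idx.tame false && val.tame false
  | .seq c d => c.wf && d.wf
  | .ite b c d => b.tame false && c.wf && d.wf
  | .iter v h c => v != 0 && v != h && !c.writes.contains v && !c.writes.contains h && c.wf

/-- The total weight of a program. -/
def weight : LProg → ℕ
  | .skip => 1
  | .store _ idx val => idx.weight + val.weight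
  | .seq c d => c.weight + d.weight
  | .ite b c d => b.weight + c.weight + d.weight
  | .iter _ _ c => c.weight + 10

/-- The bound on the cost of `N` elementary steps. -/
def costBound (K N B : ℕ) : ℕ := N * ((K + 1) * (B + K * N + 1))

/-- The second run of `N'` steps starts when `N` steps have raised the size bound by up to `K` each.
-/
theorem costBound_add (K N N' B : ℕ) :
    costBound K N B + costBound K N' (B + K * N) ≤ costBound K (N + N') B := by
  unfold costBound
  have h1 : (K + 1) * (B + K * N + 1) ≤ (K + 1) * (B + K * (N + N') + 1) :=
    Nat.mul_le_mul_left _ (by nlinarith [Nat.zero_le (K * N')])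
  have h2 : (K + 1) * (B + K * N + K * N' + 1) ≤ (K + 1) * (B + K * (N + N') + 1) :=
    Nat.mul_le_mul_left _ (by nlinarith)
  calc _ ≤ N * ((K + 1) * (B + K * (N + N') + 1)) + N' * ((K + 1) * (B + K * (N + N') + 1)) :=
        add_le_add (Nat.mul_le_mul_left _ h1) (Nat.mul_le_mul_left _ h2)
    _ = _ := by ring

theorem small_mono {m : Mem} {B B' L : ℕ} (h : m.Small B L) (hB : B ≤ B') : m.Small B' L :=
  ⟨fun a k => (h.all a k).trans hB, h.input⟩

theorem small_put {m : Mem} {B L K : ℕ} (h : m.Small B L) {a k : ℕ} (ha : a ≠ 0) {z : ℤ}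
    (hz : z.natAbs.size ≤ B + K) : (m.put a k z).Small (B + K) L := by
  refine ⟨fun b l => ?_, fun l => ?_⟩
  · rw [Mem.put_apply]; split
    · exact hz
    · exact (h.all b l).trans (by omega)
  · rw [Mem.put_ne _ _ _ ha.symm]; exact h.input l

theorem exec_store {a : ℕ} {idx val : Expr} (ha : a ≠ 0) (h1 : idx.tame false)
    (h2 : val.tame false) {K : ℕ} (hK : idx.weight + val.weight ≤ K) {m : Mem} {B L : ℕ}
    (hm : m.Small B L) (hB : K * (L + 1) ≤ B) :
    (∃ t ≤ costBound K 1 B, Exec (.store a idx val) m t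
      (m.put a (idx.eval m).toNat (val.eval m))) ∧
      (m.put a (idx.eval m).toNat (val.eval m)).Small (B + K * 1) L := by
  refine ⟨⟨_, ?_, Exec.store a idx val m⟩, ?_⟩
  · have c1 := idx.cost_le hm h1 (by omega) hB
    have c2 := val.cost_le hm h2 (by omega) hB
    have c3 : (idx.weight + val.weight) * (B + K + 1) ≤ K * (B + K + 1) :=
      Nat.mul_le_mul_right _ hK
    unfold costBound
    nlinarith
  · have := (val.size_eval_le hm).2 h2
      ((Nat.mul_le_mul_right (L + 1) (by omega : val.weight ≤ K)).trans hB)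
    rw [mul_one]
    exact small_put hm ha (by omega)

theorem test_cost {b : Expr} (h : b.tame false) {K : ℕ} (hK : b.weight ≤ K) {m : Mem} {B L : ℕ}
    (hm : m.Small B L) (hB : K * (L + 1) ≤ B) : 1 + b.cost m ≤ costBound K 1 B := by
  have c1 := b.cost_le hm h hK hB
  have c3 : b.weight * (B + K + 1) ≤ K * (B + K + 1) := Nat.mul_le_mul_right _ hK
  unfold costBound
  nlinarith

/-- A well-formed program halts in the memory given by its denotation, and its cost is quadratic
in the number of steps. -/
theorem exec_compile (K L : ℕ) (c : LProg) : c.wf → c.weight ≤ K → ∀ (m : Mem) (B : ℕ),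
    m.Small B L → K * (L + 1) ≤ B →
    (∃ t ≤ costBound K (c.steps m) B, Exec c.compile m t (c.den m)) ∧
      (c.den m).Small (B + K * c.steps m) L := by
  induction c with
  | skip =>
    intro _ _ m B hm _
    refine ⟨⟨1, ?_, Exec.skip m⟩, small_mono hm (Nat.le_add_right _ _)⟩
    simp only [costBound, steps]
    nlinarith [Nat.zero_le (K * (B + K)), Nat.zero_le B]
  | store a idx val =>
    intro h hK m B hm hB
    simp only [wf, Bool.and_eq_true, bne_iff_ne] at h
    exact exec_store h.1.1 h.1.2 h.2 hK hm hB
  | seq c d ihc ihd =>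
    intro h hK m B hm hB
    simp only [wf, Bool.and_eq_true, weight] at h hK
    obtain ⟨⟨t, ht, hc⟩, hs⟩ := ihc h.1 (by omega) m B hm hB
    obtain ⟨⟨u, hu, hd⟩, hs'⟩ := ihd h.2 (by omega) _ _ hs (hB.trans (Nat.le_add_right _ _))
    exact ⟨⟨t + u, (add_le_add ht hu).trans (costBound_add _ _ _ _), hc.seq hd⟩,
      small_mono hs' (by simp only [steps, mul_add]; omega)⟩
  | ite b c d ihc ihd =>
    intro h hK m B hm hB
    simp only [wf, Bool.and_eq_true, weight] at h hK
    have h0 := test_cost h.1.1 (by omega : _ ≤ K) hm hB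
    have hm' : m.Small (B + K * 1) L := small_mono hm (Nat.le_add_right _ _)
    have hB' : K * (L + 1) ≤ B + K * 1 := hB.trans (Nat.le_add_right _ _)
    simp only [steps, den]
    split
    next hb =>
      obtain ⟨⟨t, ht, hc⟩, hs⟩ := ihc h.1.2 (by omega) m _ hm' hB'
      exact ⟨⟨_, (add_le_add h0 ht).trans (costBound_add _ _ _ _), Exec.ite_pos hb hc⟩,
        small_mono hs (by simp only [mul_add]; omega)⟩
    next hb =>
      obtain ⟨⟨t, ht, hc⟩, hs⟩ := ihd h.2 (by omega) m _ hm' hB'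
      exact ⟨⟨_, (add_le_add h0 ht).trans (costBound_add _ _ _ _), Exec.ite_neg hb hc⟩,
        small_mono hs (by simp only [mul_add]; omega)⟩
  | iter v h c ih =>
    intro hw hK m B hm hB
    simp only [wf, Bool.and_eq_true, bne_iff_ne, Bool.not_eq_true', List.contains_eq_mem,
      decide_eq_false_iff_not, weight] at hw hK
    obtain ⟨⟨⟨⟨hv0, hvh⟩, hvc⟩, hhc⟩, hw⟩ := hw
    have w0 : intSize 0 = 1 := rfl
    have w1 : intSize 1 = 2 := rfl
    obtain ⟨⟨t₀, ht₀, hx₀⟩, hs₀⟩ := exec_store (idx := .const 0) (val := .const 0) hv0 rfl rfl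
      (by simp only [Expr.weight, w0]; omega : _ ≤ K) hm hB
    -- The machine tests `h - v > 0`, whereas the denotation fixes the number of iterations in
    -- advance. The induction is on the number `k` of remaining iterations, from an arbitrary
    -- memory.
    have loop : ∀ (k : ℕ) (s : Mem) (B : ℕ), s.Small B L → K * (L + 1) ≤ B →
        (s h 0 - s v 0).toNat = k →
        (∃ t ≤ costBound K (1 + ∑ i ∈ Finset.range k,
            (2 + c.steps ((fun s => (c.den s).put v 0 (c.den s v 0 + 1))^[i] s))) B,
          Exec (.loop (.sub (.var h) (.var v))
            (.seq c.compile (.store v (.const 0) (.add (.var v) (.const 1))))) s t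
            ((fun s => (c.den s).put v 0 (c.den s v 0 + 1))^[k] s)) ∧
        ((fun s => (c.den s).put v 0 (c.den s v 0 + 1))^[k] s).Small (B + K *
          (1 + ∑ i ∈ Finset.range k,
            (2 + c.steps ((fun s => (c.den s).put v 0 (c.den s v 0 + 1))^[i] s)))) L := by
      intro k
      induction k with
      | zero =>
        intro s B hs hB hk
        refine ⟨⟨_, ?_, Exec.loop_done ?_⟩, small_mono hs (Nat.le_add_right _ _)⟩
        · exact test_cost rfl (by simp only [Expr.weight, w0]; omega) hs hB
        · simp only [Expr.eval, Int.toNat_zero]; omega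
      | succ k ihk =>
        intro s B hs hB hk
        have h0 := test_cost (b := .sub (.var h) (.var v)) rfl
          (by simp only [Expr.weight, w0]; omega : _ ≤ K) hs hB
        have hB₁ : K * (L + 1) ≤ B + K * 1 := hB.trans (Nat.le_add_right _ _)
        obtain ⟨⟨t₁, ht₁, hx₁⟩, hs₁⟩ := ih hw (by omega) s _
          (small_mono hs (Nat.le_add_right B (K * 1))) hB₁
        have hB₂ := hB₁.trans (Nat.le_add_right _ (K * c.steps s))
        obtain ⟨⟨t₂, ht₂, hx₂⟩, hs₂⟩ := exec_store (idx := .const 0)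
          (val := .add (.var v) (.const 1)) hv0 rfl rfl
          (by simp only [Expr.weight, w0, w1]; omega : _ ≤ K) hs₁ hB₂
        have hB₃ := hB₂.trans (Nat.le_add_right _ (K * 1))
        have e : (c.den s).put v (Expr.eval (c.den s) (.const 0)).toNat
            (Expr.eval (c.den s) (.add (.var v) (.const 1))) =
            (c.den s).put v 0 (c.den s v 0 + 1) := rfl
        rw [e] at hx₂ hs₂
        obtain ⟨⟨t₃, ht₃, hx₃⟩, hs₃⟩ := ihk _ _ hs₂ hB₃ (by
          rw [Mem.put_ne _ _ _ (Ne.symm hvh), den_frame c s hhc, Mem.put_apply, den_frame c s hvc]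
          simp only [and_self, if_true]; omega)
        rw [Finset.sum_range_succ']
        simp only [Function.iterate_succ_apply, Function.iterate_zero, id] at hx₃ hs₃ ⊢
        generalize ∑ i ∈ Finset.range k, (2 + c.steps ((fun s => (c.den s).put v 0
          (c.den s v 0 + 1))^[i] ((c.den s).put v 0 (c.den s v 0 + 1)))) = Z at *
        have hN : 1 + (Z + (2 + c.steps s)) = 1 + c.steps s + 1 + (1 + Z) := by ring
        rw [hN]
        refine ⟨⟨_, ?_, Exec.loop_step ?_ (hx₁.seq hx₂) hx₃⟩, ?_⟩
        · have a1 := costBound_add K 1 (c.steps s) B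
          have a2 := costBound_add K (1 + c.steps s) 1 B
          have a3 := costBound_add K (1 + c.steps s + 1) (1 + Z) B
          simp only [mul_add, ← add_assoc] at *
          omega
        · simp only [Expr.eval, Int.toNat_zero]; omega
        · refine small_mono hs₃ (by simp only [mul_add]; omega)
    obtain ⟨⟨t, ht, hx⟩, hs⟩ := loop (m h 0).toNat (m.put v 0 0) (B + K * 1) hs₀
      (hB.trans (Nat.le_add_right _ _)) (by
        rw [Mem.put_ne _ _ _ (Ne.symm hvh), Mem.put_apply]; simp)
    have hN : (iter v h c).steps m = 1 + (1 + ∑ i ∈ Finset.range (m h 0).toNat,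
      (2 + c.steps ((fun s => (c.den s).put v 0 (c.den s v 0 + 1))^[i] (m.put v 0 0)))) := by
      simp only [steps]; ring
    rw [hN]
    exact ⟨⟨_, (add_le_add ht₀ ht).trans (costBound_add _ _ _ _), hx₀.seq hx⟩,
      small_mono hs (by simp only [mul_add]; omega)⟩

end LProg

/-! ### Running a program on an input -/

theorem intSize_le_dataSize {x : List ℤ} {z : ℤ} (hz : z ∈ x) : intSize z ≤ dataSize x :=
  List.single_le_sum (fun _ _ => Nat.zero_le _) _ (List.mem_map_of_mem hz)

theorem length_le_dataSize (x : List ℤ) : x.length ≤ dataSize x := by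
  induction x with
  | nil => simp [dataSize]
  | cons a x ih =>
    simp only [dataSize, List.map_cons, List.sum_cons, List.length_cons, intSize] at *
    omega

theorem size_le_self (k : ℕ) : k.size ≤ k := Nat.size_le.2 k.lt_two_pow_self

theorem small_inputMem (x : List ℤ) (B : ℕ) (hB : dataSize x ≤ B) :
    (inputMem x).Small B (dataSize x) := by
  have h : ∀ k, (inputMem x 0 k).natAbs.size ≤ dataSize x := by
    intro k
    simp only [inputMem, if_true]
    rcases lt_or_ge k ((x.length : ℤ) :: x).length with hk | hk
    · rw [List.getD_eq_getElem _ _ hk]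
      have := List.getElem_mem hk
      rw [List.mem_cons] at this
      rcases this with h | h
      · rw [h, Int.natAbs_natCast]
        exact (size_le_self _).trans (length_le_dataSize x)
      · have := intSize_le_dataSize h
        unfold intSize at this; omega
    · rw [List.getD_eq_default _ _ hk]; simp
  refine ⟨fun a k => ?_, h⟩
  by_cases ha : a = 0
  · subst ha; exact (h k).trans hB
  · simp [inputMem, ha]

theorem LProg.exec_inputMem (c : LProg) (hc : c.wf) (x : List ℤ) :
    ∃ t ≤ (c.weight + 1) ^ 2 * (c.steps (inputMem x) + dataSize x + 2) ^ 2,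
      Exec c.compile (inputMem x) t (c.den (inputMem x)) := by
  obtain ⟨⟨t, ht, h⟩, -⟩ := LProg.exec_compile (c.weight) (dataSize x) c hc le_rfl (inputMem x)
    ((c.weight + 1) * (dataSize x + 1)) (small_inputMem x _ (by nlinarith)) (by nlinarith)
  refine ⟨t, ht.trans ?_, h⟩
  unfold costBound
  generalize c.steps (inputMem x) = N
  generalize c.weight = K
  generalize dataSize x = D
  have h1 : (K + 1) * (D + 1) + K * N + 1 ≤ (K + 1) * (N + D + 2) := by nlinarith
  calc N * ((K + 1) * ((K + 1) * (D + 1) + K * N + 1))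
      ≤ (N + D + 2) * ((K + 1) * ((K + 1) * (N + D + 2))) := by gcongr; omega
    _ = _ := by ring


/-! ### Merging cycles of a permutation -/

section Perm

open Equiv

/-- A repetition before the first hit could be cut out, which would give an earlier hit. -/
theorem pow_apply_ne_of_first {α : Type*} {σ : Perm α} {a b : α} {k l m : ℕ}
    (hk : (σ ^ k) a = b) (hmin : ∀ l < k, (σ ^ l) a ≠ b)
    (hm : m ≤ k) (hlm : l < m) : (σ ^ l) a ≠ (σ ^ m) a := by
  intro e
  refine hmin (k - m + l) (by omega) ?_
  rw [pow_add, Perm.mul_apply, e, ← Perm.mul_apply, ← pow_add, Nat.sub_add_cancel hm, hk]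

variable {α : Type*} [Finite α] [DecidableEq α] {σ : Perm α} {a b x y : α}

/-- The walk from `x` to `a` under `σ` never meets `b`, and until it reaches `a` the new permutation
agrees with `σ`. -/
theorem sameCycle_mul_swap_left (h : ¬ σ.SameCycle a b) (hx : σ.SameCycle x a) :
    (σ * swap a b).SameCycle x a := by
  obtain ⟨k, hk⟩ := hx.exists_nat_pow_eq
  induction k generalizing x with
  | zero => exact (show x = a from hk) ▸ Perm.SameCycle.refl _ _
  | succ k ih =>
    by_cases hxa : x = a
    · exact hxa ▸ Perm.SameCycle.refl _ _
    have hxb : x ≠ b := fun e => h (e ▸ hx.symm)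
    have h1 : (σ * swap a b) x = σ x := by simp [Perm.mul_apply, swap_apply_of_ne_of_ne hxa hxb]
    have h2 := ih (x := σ x) (Perm.sameCycle_apply_left.2 hx) (by
      rw [← hk, pow_succ, Perm.mul_apply])
    rwa [← h1, Perm.sameCycle_apply_left] at h2

/-- The new successor of `a` is `σ b`; from there the old cycle of `b` is followed until it reaches
`b`. -/
theorem sameCycle_mul_swap_self (h : ¬ σ.SameCycle a b) : (σ * swap a b).SameCycle a b := by
  have h1 : (σ * swap b a).SameCycle (σ b) b :=
    sameCycle_mul_swap_left (fun e => h e.symm) (Perm.sameCycle_apply_left.2 (.refl _ _))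
  rw [swap_comm] at h1
  have h2 : (σ * swap a b) a = σ b := by simp
  rwa [← h2, Perm.sameCycle_apply_left] at h1

/-- Exchanging the successors of two elements in different cycles merges these cycles. -/
theorem sameCycle_mul_swap (h : ¬ σ.SameCycle a b) (hxy : σ.SameCycle x y) :
    (σ * swap a b).SameCycle x y := by
  have hab := sameCycle_mul_swap_self h
  have step : ∀ x, (σ * swap a b).SameCycle x (σ x) := by
    intro x
    by_cases hxa : x = a
    · subst hxa
      have : σ x = (σ * swap x b) b := by simp
      rw [this, Perm.sameCycle_apply_right]; exact hab
    by_cases hxb : x = b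
    · subst hxb
      have : σ x = (σ * swap a x) a := by simp
      rw [this, Perm.sameCycle_apply_right]; exact hab.symm
    have h1 : (σ * swap a b) x = σ x := by simp [Perm.mul_apply, swap_apply_of_ne_of_ne hxa hxb]
    rw [← h1, Perm.sameCycle_apply_right]
  obtain ⟨k, rfl⟩ := hxy.exists_nat_pow_eq
  clear hxy
  induction k with
  | zero => exact .refl _ _
  | succ k ih => rw [pow_succ', Perm.mul_apply]; exact ih.trans (step _)

end Perm

/-! ### Cyclic intervals of integers -/

/-- The number of integers congruent to `t` modulo `M` in `[S, E)`. -/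
def cov (M S E t : ℤ) : ℤ := (E - 1 - t) / M - (S - 1 - t) / M

/-- The indicator of divisibility by `M`. -/
def dvdInd (M x : ℤ) : ℤ := x / M - (x - 1) / M

theorem dvdInd_eq {M : ℤ} (hM : 0 < M) (x : ℤ) : dvdInd M x = if M ∣ x then 1 else 0 := by
  unfold dvdInd
  have h0 := Int.mul_ediv_add_emod x M
  have h1 := Int.emod_nonneg x hM.ne'
  have h2 := Int.emod_lt_of_pos x hM
  split
  next h =>
    have h3 := Int.emod_eq_zero_of_dvd h
    have : (x - 1) / M = x / M - 1 :=
      ((Int.ediv_emod_unique (r := M - 1) hM).2 ⟨by rw [mul_sub]; omega, by omega, by omega⟩).1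
    omega
  next h =>
    have h3 : x % M ≠ 0 := fun e => h (Int.dvd_of_emod_eq_zero e)
    have : (x - 1) / M = x / M :=
      ((Int.ediv_emod_unique (r := x % M - 1) hM).2 ⟨by omega, by omega, by omega⟩).1
    omega

theorem dvdInd_nonneg {M : ℤ} (hM : 0 < M) (x : ℤ) : 0 ≤ dvdInd M x := by
  rw [dvdInd_eq hM]; split <;> simp

theorem dvdInd_congr {M x y : ℤ} (hM : 0 < M) (h : M ∣ x - y) : dvdInd M x = dvdInd M y := by
  simp only [dvdInd_eq hM, dvd_iff_dvd_of_dvd_sub h]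

theorem cov_eq_one_iff {M S E t : ℤ} (hM : 0 < M) (hE : E ≤ S + M) :
    cov M S E t = 1 ↔ ∃ z, S + z * M ≤ t ∧ t < E + z * M := by
  unfold cov
  have h1 : (E - 1 - t) / M ≤ (S - 1 - t) / M + 1 := by
    rw [← Int.add_mul_ediv_right _ 1 hM.ne']
    exact Int.ediv_le_ediv hM (by omega)
  constructor
  · intro h
    have a1 := Int.ediv_mul_le (E - 1 - t) hM.ne'
    have a2 := Int.lt_ediv_add_one_mul_self (S - 1 - t) hM
    have a3 : (S - 1 - t) / M + 1 = (E - 1 - t) / M := by omega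
    rw [a3] at a2
    exact ⟨-((E - 1 - t) / M), by rw [neg_mul]; omega, by rw [neg_mul]; omega⟩
  · rintro ⟨z, hz1, hz2⟩
    have a1 : -z ≤ (E - 1 - t) / M := by
      rw [Int.le_ediv_iff_mul_le hM, neg_mul]; omega
    have a2 : (S - 1 - t) / M < -z := by
      rw [Int.ediv_lt_iff_lt_mul hM, neg_mul]; omega
    omega

theorem cov_nonneg {M S E t : ℤ} (hM : 0 < M) (hSE : S < E) : 0 ≤ cov M S E t := by
  have := Int.ediv_le_ediv hM (show S - 1 - t ≤ E - 1 - t by omega)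
  unfold cov; omega

theorem cov_eq_ite {M S E t : ℤ} (hM : 0 < M) (hSE : S < E) (hE : E ≤ S + M) :
    cov M S E t = if cov M S E t = 1 then 1 else 0 := by
  have h0 := cov_nonneg (t := t) hM hSE
  have h1 : (E - 1 - t) / M ≤ (S - 1 - t) / M + 1 := by
    rw [← Int.add_mul_ediv_right _ 1 hM.ne']
    exact Int.ediv_le_ediv hM (by omega)
  split
  · assumption
  · unfold cov at *; omega

theorem cov_periodic {M S E : ℤ} (hM : 0 < M) (t : ℤ) : cov M S E (t + M) = cov M S E t := by
  have h : ∀ x : ℤ, (x - (t + M)) / M = (x - t) / M - 1 := by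
    intro x
    rw [show x - (t + M) = x - t + (-1) * M by ring, Int.add_mul_ediv_right _ _ hM.ne']; ring
  unfold cov
  rw [h, h]; ring

theorem periodic_emod {w : ℤ → ℤ} {M : ℤ} (hw : ∀ t, w (t + M) = w t) (v : ℤ) :
    w (v % M) = w v := by
  have hp : Function.Periodic w M := hw
  have h := hp.sub_zsmul_eq (x := v) (v / M)
  rw [smul_eq_mul] at h
  rw [← h]; congr 1
  have := Int.mul_ediv_add_emod v M
  linarith [mul_comm M (v / M)]

/-- A periodic function is evaluated by summing it against the indicator of a residue class. -/
theorem sum_mul_dvdInd {M : ℕ} (hM : 0 < M) {w : ℤ → ℤ} (hw : ∀ t, w (t + M) = w t) (v : ℤ) :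
    ∑ t ∈ Finset.range M, w t * dvdInd M (t - v) = w v := by
  have hM' : (0 : ℤ) < M := by exact_mod_cast hM
  have h1 := Int.emod_nonneg v hM'.ne'
  have h2 := Int.emod_lt_of_pos v hM'
  obtain ⟨u, hu⟩ := Int.eq_ofNat_of_zero_le h1
  rw [Finset.sum_eq_single u]
  · rw [dvdInd_eq hM', if_pos, mul_one, ← hu, periodic_emod hw]
    rw [← hu, ← dvd_neg, neg_sub]; exact Int.dvd_self_sub_emod
  · intro t ht htu
    rw [dvdInd_eq hM', if_neg, mul_zero]
    intro hd
    apply htu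
    have ht' := Finset.mem_range.1 ht
    have e : (t : ℤ) % M = v % M :=
      Int.emod_eq_emod_iff_emod_sub_eq_zero.2 (Int.emod_eq_zero_of_dvd hd)
    rw [hu, Int.emod_eq_of_lt (by omega) (by omega)] at e
    omega
  · intro hnot
    exact absurd (Finset.mem_range.2 (by omega)) hnot

/-- Every integer of the interval lies in exactly one residue class. In terms of quotients: raising
`x` by one raises exactly one of the quotients `(x - t) / M`, `t < M`, by one. -/
theorem sum_cov {M : ℕ} (hM : 0 < M) (S E : ℤ) :
    ∑ t ∈ Finset.range M, cov M S E t = E - S := by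
  have hM' : (0 : ℤ) < M := by exact_mod_cast hM
  have key : ∀ x : ℤ, ∑ t ∈ Finset.range M, (x - t) / (M : ℤ) =
      ∑ t ∈ Finset.range M, (0 - (t : ℤ)) / (M : ℤ) + x := by
    have step : ∀ x : ℤ, ∑ t ∈ Finset.range M, (x + 1 - t) / (M : ℤ) =
        ∑ t ∈ Finset.range M, (x - (t : ℤ)) / (M : ℤ) + 1 := by
      intro x
      have h := sum_mul_dvdInd hM (w := fun _ => 1) (fun _ => rfl) (x + 1)
      rw [← sub_eq_iff_eq_add', ← Finset.sum_sub_distrib]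
      refine Eq.trans ?_ h
      refine Finset.sum_congr rfl fun t _ => ?_
      have e : dvdInd M (t - (x + 1)) = dvdInd M (x + 1 - t) := by
        simp only [dvdInd_eq hM', dvd_sub_comm]
      rw [one_mul, e, dvdInd, show x + 1 - (t : ℤ) - 1 = x - t by ring]
    intro x
    induction x with
    | zero => simp
    | succ i ih => rw [step, ih]; ring
    | pred i ih =>
      have := step (-(i : ℤ) - 1)
      rw [show -(i : ℤ) - 1 + 1 = -i by ring, ih] at this
      linarith
  simp only [cov, Finset.sum_sub_distrib, key (E - 1), key (S - 1)]
  ring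

/-- The number of intervals `[S i, E i)`, `i < n`, that meet the residue class of `t`. -/
def load (n : ℕ) (M : ℤ) (S E : ℕ → ℤ) (t : ℤ) : ℤ := ∑ i ∈ Finset.range n, cov M (S i) (E i) t

theorem load_periodic {n : ℕ} {M : ℤ} (hM : 0 < M) (S E : ℕ → ℤ) (t : ℤ) :
    load n M S E (t + M) = load n M S E t :=
  Finset.sum_congr rfl fun _ _ => cov_periodic hM t

/-! ### The arcs of an instance -/

/-- Arcs on the circle of integers modulo `M`, arc `a` going from `tl a` to `tl a + ln a`: the tasks,
and for every `t < M` idle arcs from `t`, of which `q - load t` have length one and the others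
have length zero. -/
structure IsArcs (n q M : ℕ) (S E tl ln : ℕ → ℤ) : Prop where
  tl_task : ∀ i < n, tl i = S i
  ln_task : ∀ i < n, ln i = E i - S i
  tl_idle : ∀ t < M, ∀ k < q, tl (n + t * q + k) = t
  ln_idle : ∀ t < M, ∀ k < q, ln (n + t * q + k) = if load n M S E t + k < q then 1 else 0

theorem sum_range_add_mul (n q M : ℕ) (F : ℕ → ℤ) :
    ∑ a ∈ Finset.range (n + M * q), F a = ∑ i ∈ Finset.range n, F i +
      ∑ t ∈ Finset.range M, ∑ k ∈ Finset.range q, F (n + t * q + k) := by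
  induction M with
  | zero => simp
  | succ M ih =>
    rw [Nat.succ_mul, ← add_assoc, Finset.sum_range_add, ih, Finset.sum_range_succ, add_assoc]

theorem sum_ite_add_lt {l : ℤ} {q : ℕ} (h0 : 0 ≤ l) (h1 : l ≤ q) :
    ∑ k ∈ Finset.range q, (if l + k < q then 1 else 0 : ℤ) = q - l := by
  obtain ⟨l, rfl⟩ := Int.eq_ofNat_of_zero_le h0
  have h1' : l ≤ q := by exact_mod_cast h1
  rw [Finset.sum_ite, Finset.sum_const_zero, add_zero, Finset.sum_const, nsmul_eq_mul, mul_one]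
  have : (Finset.range q).filter (fun k : ℕ => (l : ℤ) + k < q) = Finset.range (q - l) := by
    ext k; simp only [Finset.mem_filter, Finset.mem_range]; omega
  rw [this, Finset.card_range]; omega

/-! ### Total length and degrees of the arcs -/

namespace IsArcs

variable {n q M : ℕ} {S E tl ln : ℕ → ℤ}

/-- Each `t < M` contributes its load through the tasks covering it and `q` minus its load through
its idle arcs. -/
theorem sum_ln (h : IsArcs n q M S E tl ln) (hM : 0 < M)
    (h0 : ∀ t, 0 ≤ load n M S E t) (h1 : ∀ t, load n M S E t ≤ q) :
    ∑ a ∈ Finset.range (n + M * q), ln a = q * M := by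
  rw [sum_range_add_mul]
  have e1 : ∑ t ∈ Finset.range M, ∑ k ∈ Finset.range q, ln (n + t * q + k) =
      ∑ t ∈ Finset.range M, (q - load n M S E t) := by
    refine Finset.sum_congr rfl fun t ht => ?_
    rw [← sum_ite_add_lt (h0 t) (h1 t)]
    exact Finset.sum_congr rfl fun k hk =>
      h.ln_idle t (Finset.mem_range.1 ht) k (Finset.mem_range.1 hk)
  have e2 : ∑ i ∈ Finset.range n, ln i = ∑ t ∈ Finset.range M, load n M S E t := by
    simp only [load]
    rw [Finset.sum_comm]
    refine Finset.sum_congr rfl fun i hi => ?_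
    rw [sum_cov hM, h.ln_task i (Finset.mem_range.1 hi)]
  rw [e1, e2, ← Finset.sum_add_distrib]
  simp [mul_comm]

/-- Every vertex is the head of as many arcs as it is the tail of. -/
theorem sum_head_eq_sum_tail (h : IsArcs n q M S E tl ln) (hM : 0 < M)
    (h0 : ∀ t, 0 ≤ load n M S E t) (h1 : ∀ t, load n M S E t ≤ q) (v : ℤ) :
    ∑ a ∈ Finset.range (n + M * q), dvdInd M (tl a + ln a - v) =
      ∑ a ∈ Finset.range (n + M * q), dvdInd M (tl a - v) := by
  have hM' : (0 : ℤ) < M := by exact_mod_cast hM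
  rw [← sub_eq_zero, ← Finset.sum_sub_distrib, sum_range_add_mul]
  -- From `v - 1` to `v` the load drops by the tasks ending at `v` and grows by those starting
  -- there. The idle arcs, counted in `e2`, compensate for exactly this change.
  have e1 : ∑ i ∈ Finset.range n, (dvdInd M (tl i + ln i - v) - dvdInd M (tl i - v)) =
      load n M S E (v - 1) - load n M S E v := by
    rw [load, load, ← Finset.sum_sub_distrib]
    refine Finset.sum_congr rfl fun i hi => ?_
    rw [h.tl_task i (Finset.mem_range.1 hi), h.ln_task i (Finset.mem_range.1 hi)]
    simp only [dvdInd, cov]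
    rw [show S i + (E i - S i) - v = E i - 1 - (v - 1) by ring,
      show E i - 1 - (v - 1) - 1 = E i - 1 - v by ring,
      show S i - v - 1 = S i - 1 - v by ring, show S i - 1 - (v - 1) = S i - v by ring]
    ring
  have e2 : ∀ t ∈ Finset.range M, ∑ k ∈ Finset.range q, (dvdInd M (tl (n + t * q + k) +
      ln (n + t * q + k) - v) - dvdInd M (tl (n + t * q + k) - v)) =
      (q - load n M S E t) * dvdInd M (t - (v - 1)) - (q - load n M S E t) * dvdInd M (t - v) := by
    intro t ht
    rw [← mul_sub, ← sum_ite_add_lt (h0 t) (h1 t), Finset.sum_mul]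
    refine Finset.sum_congr rfl fun k hk => ?_
    rw [h.tl_idle t (Finset.mem_range.1 ht) k (Finset.mem_range.1 hk),
      h.ln_idle t (Finset.mem_range.1 ht) k (Finset.mem_range.1 hk)]
    split
    · rw [one_mul, show (t : ℤ) + 1 - v = t - (v - 1) by ring]
    · simp
  have hw : ∀ t : ℤ, (q : ℤ) - load n M S E (t + M) = q - load n M S E t := fun t => by
    rw [load_periodic hM']
  rw [e1, Finset.sum_congr rfl e2, Finset.sum_sub_distrib,
    sum_mul_dvdInd hM (w := fun t => q - load n M S E t) hw,
    sum_mul_dvdInd hM (w := fun t => q - load n M S E t) hw]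
  ring

end IsArcs


open Equiv

/-! ### Unrolling a closed walk -/

/-- `b` is reached from `o` for the first time after `k` steps. -/
def FirstHit {α : Type*} (σ : Perm α) (o b : α) (k : ℕ) : Prop :=
  (σ ^ k) o = b ∧ ∀ l < k, (σ ^ l) o ≠ b

/-- The position, on the unrolled walk from `o`, of the tail of the `k`th arc. -/
def walkPos {A : ℕ} (tl ln : ℕ → ℤ) (σ : Perm (Fin A)) (o : Fin A) (k : ℕ) : ℤ :=
  tl o + ∑ l ∈ Finset.range k, ln ((σ ^ l) o : Fin A)

theorem dvd_walkPos_sub {A : ℕ} {M : ℤ} {tl ln : ℕ → ℤ} {σ : Perm (Fin A)}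
    (h : ∀ x : Fin A, M ∣ tl x + ln x - tl (σ x)) (o : Fin A) (k : ℕ) :
    M ∣ walkPos tl ln σ o k - tl ((σ ^ k) o : Fin A) := by
  induction k with
  | zero => simp [walkPos]
  | succ k ih =>
    have h1 := h ((σ ^ k) o)
    have h2 : walkPos tl ln σ o (k + 1) = walkPos tl ln σ o k + ln ((σ ^ k) o : Fin A) := by
      rw [walkPos, Finset.sum_range_succ, walkPos]; ring
    rw [h2, pow_succ', Perm.mul_apply]
    obtain ⟨u, hu⟩ := ih
    obtain ⟨v, hv⟩ := h1
    exact ⟨u + v, by rw [mul_add]; linarith⟩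

/-- Up to its first visit to `b` the walk repeats no arc, so the arcs with indices from `k` to `k'`
are distinct and their lengths sum to at most the total. The two bounds say that arcs `k` and `k'`
are disjoint on a circle of that total length. -/
theorem walkPos_le {A : ℕ} {tl ln : ℕ → ℤ} {σ : Perm (Fin A)} {o b : Fin A} {k k' : ℕ}
    (hln : ∀ x : Fin A, 0 ≤ ln x) (hk : k < k') (hb : FirstHit σ o b k') :
    walkPos tl ln σ o k + ln ((σ ^ k) o : Fin A) ≤ walkPos tl ln σ o k' ∧
    walkPos tl ln σ o k' + ln b ≤ walkPos tl ln σ o k + ∑ x : Fin A, ln x := by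
  have e1 : walkPos tl ln σ o k + ln ((σ ^ k) o : Fin A) = walkPos tl ln σ o (k + 1) := by
    rw [walkPos, walkPos, Finset.sum_range_succ]; ring
  have e2 : walkPos tl ln σ o k' + ln b = walkPos tl ln σ o (k' + 1) := by
    rw [walkPos, walkPos, Finset.sum_range_succ, hb.1]; ring
  constructor
  · rw [e1, walkPos, walkPos]
    refine add_le_add_right (Finset.sum_le_sum_of_subset_of_nonneg ?_ fun _ _ _ => hln _) _
    exact Finset.range_subset_range.2 hk
  · rw [e2, walkPos, walkPos, add_assoc]
    refine add_le_add_right ?_ _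
    rw [← Finset.sum_range_add_sum_Ico _ (by omega : k ≤ k' + 1)]
    refine add_le_add_right ?_ _
    have inj : Set.InjOn (fun l => (σ ^ l) o) (Finset.Ico k (k' + 1) : Finset ℕ) := by
      intro l hl m hm e
      simp only [Finset.coe_Ico, Set.mem_Ico] at hl hm
      rcases lt_trichotomy l m with h | h | h
      · exact absurd e (pow_apply_ne_of_first hb.1 hb.2 (by omega) h)
      · exact h
      · exact absurd e.symm (pow_apply_ne_of_first hb.1 hb.2 (by omega) h)
    rw [← Finset.sum_image (f := fun x : Fin A => ln x) inj]
    exact Finset.sum_le_sum_of_subset_of_nonneg (Finset.subset_univ _) fun _ _ _ => hln _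

/-- Intervals placed on disjoint parts of a circle of length `q * M` are never performed
simultaneously by the same worker. -/
theorem not_dvd_of_disjoint {q M : ℕ} {x x' c c' S S' l l' r r' T : ℤ}
    (hx : x = S + c * M) (hx' : x' = S' + c' * M) (h1 : x + l ≤ x') (h2 : x' + l' ≤ x + q * M)
    (hT1 : S + r * M ≤ T) (hT2 : T < S + l + r * M) (hT1' : S' + r' * M ≤ T)
    (hT2' : T < S' + l' + r' * M) : ¬ (q : ℤ) ∣ (c - r) - (c' - r') := by
  rintro ⟨z, hz⟩
  -- A common worker would put both occurrences, at time `T`, on the same point of the circle of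
  -- length `q * M`. The two bounds below place a multiple of `q * M` strictly between `-(q * M)`
  -- and `0`.
  have e : (c - r) * M - (c' - r') * M = z * (q * M) := by rw [← sub_mul, hz]; ring
  have b1 : z * ((q : ℤ) * M) < 0 := by nlinarith
  have b2 : -((q : ℤ) * M) < z * (q * M) := by nlinarith
  have hqM : 0 ≤ (q : ℤ) * M := by positivity
  rcases lt_or_ge z 0 with hz | hz
  · nlinarith
  · nlinarith

/-! ### From a closed walk to offsets without conflicts -/

namespace IsArcs

variable {n q M : ℕ} {S E tl ln : ℕ → ℤ}

theorem ln_nonneg (h : IsArcs n q M S E tl ln) (hSE : ∀ i < n, S i < E i)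
    (x : Fin (n + M * q)) : 0 ≤ ln x := by
  rcases lt_or_ge (x : ℕ) n with hx | hx
  · rw [h.ln_task x hx]; have := hSE x hx; omega
  · have hlt : (x : ℕ) - n < M * q := by omega
    have hq : 0 < q := by
      rcases Nat.eq_zero_or_pos q with rfl | hq
      · simp at hlt
      · exact hq
    have e : (x : ℕ) = n + ((x : ℕ) - n) / q * q + ((x : ℕ) - n) % q := by
      rw [add_assoc, Nat.div_add_mod']; omega
    rw [e, h.ln_idle _ ((Nat.div_lt_iff_lt_mul hq).2 hlt) _ (Nat.mod_lt _ hq)]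
    split <;> simp

/-- If all tasks lie on a closed walk that uses every arc at most once, their positions on this
walk give numbers `c` such that worker `c i - r` (modulo `q`) may perform the `r`th occurrence of
task `i`. -/
theorem not_dvd (h : IsArcs n q M S E tl ln) (hM : 0 < M) (hSE : ∀ i < n, S i < E i)
    (h1 : ∀ t, load n M S E t ≤ q) {σ : Perm (Fin (n + M * q))}
    (hσ : ∀ x : Fin (n + M * q), (M : ℤ) ∣ tl x + ln x - tl (σ x)) {o : Fin (n + M * q)}
    {K : ℕ → ℕ} (hK : ∀ i (hi : i < n), FirstHit σ o ⟨i, by omega⟩ (K i)) {i i' : ℕ} (hi : i < n)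
    (hi' : i' < n) (hne : i ≠ i') {r r' T : ℤ}
    (hT1 : S i + r * M ≤ T) (hT2 : T < E i + r * M) (hT1' : S i' + r' * M ≤ T)
    (hT2' : T < E i' + r' * M) :
    ¬ (q : ℤ) ∣ ((walkPos tl ln σ o (K i) - S i) / M - r) -
      ((walkPos tl ln σ o (K i') - S i') / M - r') := by
  have hM' : (0 : ℤ) < M := by exact_mod_cast hM
  have h0 : ∀ t, 0 ≤ load n M S E t := fun t =>
    Finset.sum_nonneg fun i hi => cov_nonneg hM' (hSE i (Finset.mem_range.1 hi))
  have hsum : ∑ x : Fin (n + M * q), ln x = q * M := by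
    rw [Fin.sum_univ_eq_sum_range (fun a => ln a), h.sum_ln hM h0 h1]
  have place : ∀ i < n, walkPos tl ln σ o (K i) =
      S i + (walkPos tl ln σ o (K i) - S i) / M * M := by
    intro i hi
    have := dvd_walkPos_sub hσ o (K i)
    rw [(hK i hi).1, h.tl_task i hi] at this
    rw [Int.ediv_mul_cancel this]; ring
  have main : ∀ i i' (hi : i < n) (hi' : i' < n) (r r' : ℤ), K i < K i' →
      S i + r * M ≤ T → T < E i + r * M → S i' + r' * M ≤ T → T < E i' + r' * M →
      ¬ (q : ℤ) ∣ ((walkPos tl ln σ o (K i) - S i) / M - r) -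
      ((walkPos tl ln σ o (K i') - S i') / M - r') := by
    intro i i' hi hi' r r' hlt a1 a2 a3 a4
    obtain ⟨b1, b2⟩ := walkPos_le (tl := tl) (h.ln_nonneg hSE) hlt (hK i' hi')
    rw [(hK i hi).1] at b1
    rw [hsum] at b2
    have l1 := h.ln_task i hi
    have l2 := h.ln_task i' hi'
    exact not_dvd_of_disjoint (place i hi) (place i' hi') b1 b2 a1 (by simp only; omega) a3
      (by simp only; omega)
  -- Equal indices on the walk would mean the same arc; the two strict cases are symmetric.
  rcases lt_trichotomy (K i) (K i') with hlt | heq | hlt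
  · exact main i i' hi hi' r r' hlt hT1 hT2 hT1' hT2'
  · exfalso
    have := (hK i hi).1.symm.trans ((congrArg (fun k => (σ ^ k) o) heq).trans (hK i' hi').1)
    exact hne (by simpa using this)
  · rw [dvd_sub_comm]
    exact main i' i hi' hi r' r hlt hT1' hT2' hT1 hT2

end IsArcs

/-! ### Necessity -/

/-- An assignment in integer time in which every worker performs every task infinitely often. -/
structure Schedule (n q : ℕ) (M : ℕ) (S E : ℕ → ℤ) (f : Fin n → ℕ+ → Fin q) : Prop where
  feasible : ∀ (i i' : Fin n) (r r' : ℕ+) (T : ℤ), i ≠ i' → S i + (r : ℕ) * M ≤ T →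
    T < E i + (r : ℕ) * M → S i' + (r' : ℕ) * M ≤ T → T < E i' + (r' : ℕ) * M → f i r ≠ f i' r'
  recurs : ∀ (i : Fin n) (j : Fin q) (R : ℕ), ∃ r : ℕ+, R ≤ r ∧ f i r = j

namespace Schedule

variable {n q M : ℕ} {S E : ℕ → ℤ} {f : Fin n → ℕ+ → Fin q}

/-- Occurrences are numbered from one; `E i ≤ T` excludes the translates with `z ≤ 0`. -/
theorem exists_occ (hM : 0 < M) {i : ℕ} (hE : E i ≤ S i + M)
    {T : ℤ} (hT : E i ≤ T) (hc : cov M (S i) (E i) T = 1) :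
    ∃ r : ℕ+, S i + (r : ℕ) * M ≤ T ∧ T < E i + (r : ℕ) * M := by
  have hM' : (0 : ℤ) < M := by exact_mod_cast hM
  obtain ⟨z, h1, h2⟩ := (cov_eq_one_iff hM' hE).1 hc
  have hz : 0 < z := by
    by_contra hz
    have : z * M ≤ 0 := by nlinarith
    omega
  obtain ⟨r, rfl⟩ := Int.eq_ofNat_of_zero_le hz.le
  exact ⟨⟨r, by exact_mod_cast hz⟩, h1, h2⟩

theorem load_eq_card (hM : 0 < M) (hSE : ∀ i < n, S i < E i) (hE : ∀ i < n, E i ≤ S i + M)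
    (T : ℤ) : load n M S E T =
      ((Finset.univ : Finset (Fin n)).filter fun i : Fin n => cov M (S i) (E i) T = 1).card := by
  have hM' : (0 : ℤ) < M := by exact_mod_cast hM
  rw [load, ← Fin.sum_univ_eq_sum_range (fun i => cov M (S i) (E i) T),
    Finset.card_filter, Nat.cast_sum]
  refine Finset.sum_congr rfl fun i _ => ?_
  rw [cov_eq_ite hM' (hSE i i.2) (hE i i.2)]
  simp

/-- The tasks running at `T` have distinct workers outside `J`. With `J = ∅` this bounds the load;
with `J = {j}` it shows that an idle worker leaves room for an idle arc of length one. -/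
theorem load_add_card_le (hf : Schedule n q M S E f) (hM : 0 < M) (hSE : ∀ i < n, S i < E i)
    (hE : ∀ i < n, E i ≤ S i + M) {T : ℤ} (hT : ∀ i < n, E i ≤ T) (J : Finset (Fin q))
    (hJ : ∀ (i : Fin n) (r : ℕ+), S i + (r : ℕ) * M ≤ T → T < E i + (r : ℕ) * M → f i r ∉ J) :
    load n M S E T + J.card ≤ q := by
  rw [load_eq_card hM hSE hE]
  have hex : ∀ i : Fin n, ∃ r : ℕ+, cov M (S i) (E i) T = 1 →
      S i + (r : ℕ) * M ≤ T ∧ T < E i + (r : ℕ) * M := by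
    intro i
    by_cases hc : cov M (S i) (E i) T = 1
    · obtain ⟨r, hr⟩ := exists_occ hM (hE i i.2) (hT i i.2) hc
      exact ⟨r, fun _ => hr⟩
    · exact ⟨1, fun h => absurd h hc⟩
  choose ρ hρ using hex
  set C := (Finset.univ : Finset (Fin n)).filter fun i : Fin n => cov M (S i) (E i) T = 1 with hC
  have inj : Set.InjOn (fun i => f i (ρ i)) C := by
    intro i hi i' hi' e
    simp only [hC, Finset.coe_filter, Finset.mem_univ, true_and, Set.mem_ofPred_eq] at hi hi'
    by_contra hne
    exact hf.feasible i i' _ _ T hne (hρ i hi).1 (hρ i hi).2 (hρ i' hi').1 (hρ i' hi').2 e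
  have hdisj : Disjoint (C.image fun i => f i (ρ i)) J := by
    rw [Finset.disjoint_left]
    intro j hj
    obtain ⟨i, hi, rfl⟩ := Finset.mem_image.1 hj
    have hi' := (Finset.mem_filter.1 hi).2
    exact hJ i _ (hρ i hi').1 (hρ i hi').2
  have := Finset.card_le_univ ((C.image fun i => f i (ρ i)) ∪ J)
  rw [Finset.card_union_of_disjoint hdisj, Finset.card_image_of_injOn inj, Fintype.card_fin] at this
  exact_mod_cast this

/-- By periodicity `t` can be moved beyond all `E i`, where every covering interval is an actual
occurrence. -/
theorem load_le (hf : Schedule n q M S E f) (hM : 0 < M) (hSE : ∀ i < n, S i < E i)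
    (hE : ∀ i < n, E i ≤ S i + M) {b : ℤ} (hb : ∀ i < n, E i ≤ b) (t : ℤ) :
    load n M S E t ≤ q := by
  have hM' : (0 : ℤ) < M := by exact_mod_cast hM
  have hper : Function.Periodic (load n M S E) M := load_periodic hM' S E
  have e := hper.zsmul (|b - t|) t
  rw [← e]
  have := hf.load_add_card_le hM hSE hE (T := t + |b - t| • (M : ℤ)) (fun i hi => by
    have h1 := hb i hi
    have h2 := le_abs_self (b - t)
    have h3 := abs_nonneg (b - t)
    rw [smul_eq_mul]
    nlinarith) ∅ (by simp)
  simpa using this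

/-- Worker `j` traverses arc `a` at time `T`. -/
def Traverses (M : ℕ) (S E : ℕ → ℤ) (f : Fin n → ℕ+ → Fin q) (j : Fin q) (T : ℤ) (a : ℕ) : Prop :=
  (∃ (i : Fin n) (r : ℕ+), a = i ∧ S i + (r : ℕ) * M ≤ T ∧ T < E i + (r : ℕ) * M ∧ f i r = j) ∨
  ((∀ (i : Fin n) (r : ℕ+), S i + (r : ℕ) * M ≤ T → T < E i + (r : ℕ) * M → f i r ≠ j) ∧
    a = n + (T % M).toNat * q)

theorem traverses_lt (hM : 0 < M) {j : Fin q} {T : ℤ} {a : ℕ} (h : Traverses M S E f j T a) :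
    a < n + M * q := by
  have hM' : (0 : ℤ) < M := by exact_mod_cast hM
  rcases h with ⟨i, r, rfl, -⟩ | ⟨-, rfl⟩
  · have := i.2; omega
  · have h2 := Int.emod_lt_of_pos T hM'
    have h3 : (T % M).toNat + 1 ≤ M := by omega
    have := Nat.mul_le_mul_right q h3
    have := j.pos
    rw [Nat.succ_mul] at *
    omega

theorem exists_traverses (M : ℕ) (S E : ℕ → ℤ) (f : Fin n → ℕ+ → Fin q) (j : Fin q) (T : ℤ) :
    ∃ a, Traverses M S E f j T a := by
  by_cases h : ∃ (i : Fin n) (r : ℕ+), S i + (r : ℕ) * M ≤ T ∧ T < E i + (r : ℕ) * M ∧ f i r = j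
  · obtain ⟨i, r, h1, h2, h3⟩ := h
    exact ⟨i, .inl ⟨i, r, rfl, h1, h2, h3⟩⟩
  · push Not at h
    exact ⟨_, .inr ⟨h, rfl⟩⟩

/-- By feasibility a worker neither leaves a task before its end nor enters one after its start. So
when the arc changes, the old one ends and the new one begins at `T + 1`. The alternative `a = b`
covers a task still in progress. -/
theorem dvd_of_traverses (hf : Schedule n q M S E f) (hM : 0 < M) (hSE : ∀ i < n, S i < E i)
    (hE : ∀ i < n, E i ≤ S i + M) {tl ln : ℕ → ℤ} (harcs : IsArcs n q M S E tl ln)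
    {j : Fin q} {T : ℤ} (hT : ∀ i < n, E i ≤ T) {a b : ℕ} (ha : Traverses M S E f j T a)
    (hb : Traverses M S E f j (T + 1) b) : a = b ∨ (M : ℤ) ∣ tl a + ln a - tl b := by
  have hM' : (0 : ℤ) < M := by exact_mod_cast hM
  by_cases hab : a = b
  · exact .inl hab
  right
  have idle : ∀ T : ℤ, (T % M).toNat < M ∧ (((T % M).toNat : ℕ) : ℤ) = T % M := fun T => by
    have h1 := Int.emod_nonneg T hM'.ne'
    have h2 := Int.emod_lt_of_pos T hM'
    omega
  have head : (M : ℤ) ∣ tl a + ln a - (T + 1) := by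
    rcases ha with ⟨i, r, rfl, h1, h2, h3⟩ | ⟨hidle, rfl⟩
    · have hend : ¬ T + 1 < E i + (r : ℕ) * M := by
        intro hlt
        rcases hb with ⟨i', r', rfl, h1', h2', h3'⟩ | ⟨hidle, -⟩
        · exact hf.feasible i i' r r' (T + 1) (fun e => hab (by rw [e])) (by omega) hlt h1' h2'
            (h3.trans h3'.symm)
        · exact hidle i r (by omega) hlt h3
      rw [harcs.tl_task i i.2, harcs.ln_task i i.2]
      exact ⟨-(r : ℕ), by linarith [mul_comm (M : ℤ) (-(r : ℕ)), neg_mul ((r : ℕ) : ℤ) (M : ℤ)]⟩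
    · obtain ⟨h1, h2⟩ := idle T
      -- As `j` is idle, the load at `T` is at most `q - 1`; hence the idle arc with `k = 0`, the
      -- one chosen in `Traverses`, has length one.
      have hl := hf.load_add_card_le hM hSE hE hT {j} (fun i r a1 a2 => by
        rw [Finset.mem_singleton]; exact hidle i r a1 a2)
      rw [Finset.card_singleton] at hl
      have t1 := harcs.tl_idle _ h1 0 j.pos
      have t2 := harcs.ln_idle _ h1 0 j.pos
      rw [h2, periodic_emod (load_periodic hM' S E), if_pos (by push_cast at *; omega)] at t2
      rw [add_zero] at t1 t2
      rw [t1, t2, h2, show T % (M : ℤ) + 1 - (T + 1) = T % M - T by ring, dvd_sub_comm]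
      exact Int.dvd_self_sub_emod
  have tail : (M : ℤ) ∣ tl b - (T + 1) := by
    rcases hb with ⟨i, r, rfl, h1, h2, h3⟩ | ⟨hidle, rfl⟩
    · have hstart : ¬ S i + (r : ℕ) * M ≤ T := by
        intro hle
        rcases ha with ⟨i', r', rfl, h1', h2', h3'⟩ | ⟨hidle, -⟩
        · exact hf.feasible i i' r r' T (fun e => hab (by rw [e])) hle (by omega) h1' h2'
            (h3.trans h3'.symm)
        · exact hidle i r hle (by omega) h3
      rw [harcs.tl_task i i.2]
      exact ⟨-(r : ℕ), by linarith [mul_comm (M : ℤ) (-(r : ℕ)), neg_mul ((r : ℕ) : ℤ) (M : ℤ)]⟩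
    · obtain ⟨h1, h2⟩ := idle (T + 1)
      have t1 := harcs.tl_idle _ h1 0 j.pos
      rw [add_zero] at t1
      rw [t1, h2, dvd_sub_comm]
      exact Int.dvd_self_sub_emod
  obtain ⟨u, hu⟩ := head
  obtain ⟨v, hv⟩ := tail
  exact ⟨u - v, by rw [mul_sub]; linarith⟩

/-- All tasks lie in the same component of the graph formed by the arcs. -/
theorem tasks_connected (hf : Schedule n q M S E f) (hq : 0 < q) (hM : 0 < M)
    (hSE : ∀ i < n, S i < E i) (hE : ∀ i < n, E i ≤ S i + M) {tl ln : ℕ → ℤ}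
    (harcs : IsArcs n q M S E tl ln) {b : ℤ} (hb : ∀ i < n, E i ≤ b) (Rel : ℕ → ℕ → Prop)
    (hrefl : ∀ a, Rel a a) (htrans : ∀ x y z, Rel x y → Rel y z → Rel x z)
    (hrel : ∀ x y, x < n + M * q → y < n + M * q → (M : ℤ) ∣ tl x + ln x - tl y → Rel x y)
    (i i' : Fin n) : Rel i i' := by
  have hM' : (0 : ℤ) < M := by exact_mod_cast hM
  -- The premise for `k = 0` avoids proving that the arc traversed by a worker at a given time is
  -- unique.
  have key : ∀ (j : Fin q) (T : ℤ), b ≤ T → ∀ (k : ℕ) {x y : ℕ}, Traverses M S E f j T x →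
      Traverses M S E f j (T + k) y → (k = 0 → x = y) → Rel x y := by
    intro j T hT k
    induction k with
    | zero => intro x y _ _ h; rw [h rfl]; exact hrefl _
    | succ k ih =>
      intro x y hx hy _
      obtain ⟨z, hz, hxz⟩ : ∃ z, Traverses M S E f j (T + k) z ∧ (k = 0 → x = z) := by
        by_cases hk : k = 0
        · subst hk; exact ⟨x, by simpa using hx, fun _ => rfl⟩
        · obtain ⟨z, hz⟩ := exists_traverses M S E f j (T + k)
          exact ⟨z, hz, fun h => absurd h hk⟩
      have h1 := ih hx hz hxz
      have hy' : Traverses M S E f j (T + k + 1) y := by push_cast at hy; rwa [add_assoc]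
      rcases hf.dvd_of_traverses hM hSE hE harcs
        (fun i hi => (hb i hi).trans (by omega)) hz hy' with h | h
      · exact h ▸ h1
      · exact htrans _ _ _ h1 (hrel _ _ (traverses_lt hM hz) (traverses_lt hM hy') h)
  let j : Fin q := ⟨0, hq⟩
  -- Worker `j` performs `i` at some time after `b`, and `i'` later still; following `j` in between
  -- connects the two tasks.
  obtain ⟨r, hr, hj⟩ := hf.recurs i j (b - S i).toNat
  obtain ⟨r', hr', hj'⟩ := hf.recurs i' j (S i + (r : ℕ) * M + 1 - S i').toNat
  have a1 : ∀ r : ℕ, (r : ℤ) ≤ r * M := fun r => by nlinarith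
  have b1 : b ≤ S i + (r : ℕ) * M := by have := a1 r; omega
  have b2 : S i + (r : ℕ) * M < S i' + (r' : ℕ) * M := by have := a1 r'; omega
  have e : S i + (r : ℕ) * M +
      ((S i' + (r' : ℕ) * M - (S i + (r : ℕ) * M)).toNat : ℕ) = S i' + (r' : ℕ) * M := by omega
  refine key j _ b1 (S i' + (r' : ℕ) * M - (S i + (r : ℕ) * M)).toNat
    (.inl ⟨i, r, rfl, le_rfl, ?_, hj⟩) (.inl ⟨i', r', rfl, ?_, ?_, hj'⟩) (fun h => by omega)
  · have := hSE i i.2; omega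
  · rw [e]
  · rw [e]; have := hSE i' i'.2; omega

end Schedule


namespace TaskInstance

variable (I : TaskInstance)

/-! ### Integer time -/

/-- The endpoints of the tasks: `s 0, e 0, s 1, e 1, …`. -/
def endpoint (u : ℕ) : ℚ :=
  if h : u / 2 < I.n then (if u % 2 = 0 then I.s ⟨u / 2, h⟩ else I.e ⟨u / 2, h⟩) else 0

/-- The rank of a point of time among all translates of the endpoints. -/
def rank (x : ℚ) : ℤ := ∑ u ∈ Finset.range (2 * I.n), ⌈x - I.endpoint u⌉

/-- The start of a task in integer time. -/
def start (i : ℕ) : ℤ := I.rank (I.endpoint (2 * i))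

/-- The end of a task in integer time. -/
def finish (i : ℕ) : ℤ := I.rank (I.endpoint (2 * i + 1))

theorem endpoint_even (i : Fin I.n) : I.endpoint (2 * i) = I.s i := by
  have : 2 * (i : ℕ) / 2 = i := by omega
  simp [endpoint, this]

theorem endpoint_odd (i : Fin I.n) : I.endpoint (2 * i + 1) = I.e i := by
  have h1 : (2 * (i : ℕ) + 1) / 2 = i := by omega
  have h2 : (2 * (i : ℕ) + 1) % 2 = 1 := by omega
  simp [endpoint, h1, h2]

theorem endpoint_bounds (u : ℕ) : -1 < I.endpoint u ∧ I.endpoint u ≤ 1 := by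
  unfold endpoint
  split
  next h =>
    have h1 := I.neg_one_lt_s ⟨u / 2, h⟩
    have h2 := I.s_lt_e ⟨u / 2, h⟩
    have h3 := I.e_le_one ⟨u / 2, h⟩
    split <;> constructor <;> linarith
  next => norm_num

/-- Each of the `2 n` ceilings grows by `r`, so one period is `2 n` units of integer time, even if
some endpoints coincide. -/
theorem rank_add_int (x : ℚ) (r : ℤ) : I.rank (x + r) = I.rank x + r * (2 * I.n : ℕ) := by
  have : ∀ u, ⌈x + r - I.endpoint u⌉ = ⌈x - I.endpoint u⌉ + r := fun u => by
    rw [← Int.ceil_add_intCast]; congr 1; ring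
  simp only [rank, this, Finset.sum_add_distrib, Finset.sum_const, Finset.card_range, nsmul_eq_mul]
  ring

theorem rank_mono {x y : ℚ} (h : x ≤ y) : I.rank x ≤ I.rank y :=
  Finset.sum_le_sum fun u _ => Int.ceil_mono (by linarith)

/-- At a translate of endpoint `u` the `u`th ceiling is exact, so it jumps immediately afterwards.
-/
theorem rank_lt {u : ℕ} (hu : u < 2 * I.n) {r : ℤ} {y : ℚ} (h : I.endpoint u + r < y) :
    I.rank (I.endpoint u + r) < I.rank y := by
  refine Finset.sum_lt_sum (fun v _ => Int.ceil_mono (by linarith)) ⟨u, Finset.mem_range.2 hu, ?_⟩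
  rw [add_sub_cancel_left, Int.ceil_intCast]
  exact Int.lt_ceil.2 (by linarith)

theorem abs_rank_endpoint_le (u : ℕ) : |I.rank (I.endpoint u)| ≤ 2 * (2 * I.n : ℕ) := by
  refine (Finset.abs_sum_le_sum_abs _ _).trans ?_
  have : ∀ v ∈ Finset.range (2 * I.n), |⌈I.endpoint u - I.endpoint v⌉| ≤ 2 := by
    intro v _
    have h1 := I.endpoint_bounds u
    have h2 := I.endpoint_bounds v
    rw [abs_le]
    constructor
    · have : (-2 : ℤ) < ⌈I.endpoint u - I.endpoint v⌉ := Int.lt_ceil.2 (by push_cast; linarith)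
      omega
    · exact Int.ceil_le.2 (by push_cast; linarith)
  refine (Finset.sum_le_sum this).trans ?_
  simp; ring_nf; rfl

theorem start_lt_finish (i : ℕ) (hi : i < I.n) : I.start i < I.finish i := by
  have h := I.s_lt_e ⟨i, hi⟩
  have := I.rank_lt (u := 2 * i) (by omega) (r := 0) (y := I.endpoint (2 * i + 1)) (by
    rw [I.endpoint_even ⟨i, hi⟩, I.endpoint_odd ⟨i, hi⟩]; simpa using h)
  simpa [start, finish] using this

theorem finish_le (i : ℕ) (hi : i < I.n) : I.finish i ≤ I.start i + (2 * I.n : ℕ) := by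
  have h := I.length_le_one ⟨i, hi⟩
  have := I.rank_add_int (I.endpoint (2 * i)) 1
  rw [one_mul] at this
  rw [start, ← this, finish]
  refine I.rank_mono ?_
  rw [I.endpoint_even ⟨i, hi⟩, I.endpoint_odd ⟨i, hi⟩]; push_cast; linarith

theorem finish_le_bound (i : ℕ) : I.finish i ≤ 2 * (2 * I.n : ℕ) :=
  (le_abs_self _).trans (I.abs_rank_endpoint_le _)

/-- Overlaps of half-open intervals depend only on strict comparisons of a start with an end.
Monotonicity of `rank` gives one direction, its jump at endpoints the other. -/
theorem start_add_lt_finish_add_iff (i i' : Fin I.n) (r r' : ℤ) :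
    I.start i + r * (2 * I.n : ℕ) < I.finish i' + r' * (2 * I.n : ℕ) ↔
      I.s i + r < I.e i' + r' := by
  rw [start, finish, ← rank_add_int, ← rank_add_int, endpoint_odd]
  constructor
  · intro h
    by_contra hle
    rw [endpoint_even] at h
    exact absurd (I.rank_mono (not_lt.1 hle)) (not_le.2 h)
  · intro h
    exact I.rank_lt (by have := i.2; omega) (by rwa [endpoint_even])

theorem overlap_iff (i i' : Fin I.n) (r r' : ℕ+) : (I.occ i r ∩ I.occ i' r').Nonempty ↔
    I.s i + ((r : ℕ) : ℤ) < I.e i' + ((r' : ℕ) : ℤ) ∧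
      I.s i' + ((r' : ℕ) : ℤ) < I.e i + ((r : ℕ) : ℤ) := by
  have h1 := I.s_lt_e i
  have h2 := I.s_lt_e i'
  rw [occ, occ, Set.Ico_inter_Ico, Set.nonempty_Ico, max_lt_iff, lt_min_iff, lt_min_iff]
  have h1' : (I.s i : ℝ) < I.e i := by exact_mod_cast h1
  have h2' : (I.s i' : ℝ) < I.e i' := by exact_mod_cast h2
  have c1 : ((I.s i : ℝ) + (r : ℕ) < I.e i' + (r' : ℕ)) ↔
    I.s i + ((r : ℕ) : ℤ) < I.e i' + ((r' : ℕ) : ℤ) := by norm_cast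
  have c2 : ((I.s i' : ℝ) + (r' : ℕ) < I.e i + (r : ℕ)) ↔
    I.s i' + ((r' : ℕ) : ℤ) < I.e i + ((r : ℕ) : ℤ) := by norm_cast
  rw [← c1, ← c2]
  constructor
  · rintro ⟨⟨-, h⟩, h', -⟩; exact ⟨h, h'⟩
  · rintro ⟨h, h'⟩; exact ⟨⟨by linarith, h⟩, h', by linarith⟩

/-- Overlaps can be detected in integer time. -/
theorem overlap_iff_exists (i i' : Fin I.n) (r r' : ℕ+) :
    (I.occ i r ∩ I.occ i' r').Nonempty ↔ ∃ T : ℤ,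
      I.start i + (r : ℕ) * (2 * I.n : ℕ) ≤ T ∧ T < I.finish i + (r : ℕ) * (2 * I.n : ℕ) ∧
      I.start i' + (r' : ℕ) * (2 * I.n : ℕ) ≤ T ∧ T < I.finish i' + (r' : ℕ) * (2 * I.n : ℕ) := by
  rw [overlap_iff, ← start_add_lt_finish_add_iff, ← start_add_lt_finish_add_iff]
  have h1 := I.start_lt_finish i i.2
  have h2 := I.start_lt_finish i' i'.2
  constructor
  · rintro ⟨h, h'⟩
    refine ⟨max (I.start i + (r : ℕ) * (2 * I.n : ℕ)) (I.start i' + (r' : ℕ) * (2 * I.n : ℕ)),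
      le_max_left _ _, max_lt ?_ h', le_max_right _ _, max_lt h ?_⟩ <;> omega
  · rintro ⟨T, a, b, c, d⟩
    exact ⟨a.trans_lt d, c.trans_lt b⟩

/-- Of balance only recurrence is retained: a worker performing a task finitely often has frequency
`0` there, not `1 / q`. -/
theorem schedule_of_balanced {f : I.Assignment} (hf : I.Feasible f) (hb : I.Balanced f) :
    Schedule I.n I.q (2 * I.n) I.start I.finish f where
  feasible i i' r r' T hne h1 h2 h3 h4 :=
    hf i i' r r' hne ((I.overlap_iff_exists i i' r r').2 ⟨T, h1, h2, h3, h4⟩)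
  recurs i j R := by
    by_contra! hcon
    have hlim := hb i j
    have hbd : ∀ t : ℕ, ((Finset.range t).filter fun k => f i k.succPNat = j).card ≤ R := by
      intro t
      rw [← Finset.card_range R]
      refine Finset.card_le_card fun k hk => ?_
      rw [Finset.mem_filter] at hk
      by_contra hkR
      refine hcon k.succPNat ?_ hk.2
      rw [Finset.mem_range] at hkR
      rw [Nat.succPNat_coe]; omega
    have h0 : Filter.Tendsto (fun t : ℕ => (1 / (t : ℝ)) *
        (((Finset.range t).filter fun k => f i k.succPNat = j).card : ℝ)) Filter.atTop (nhds 0) := by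
      refine squeeze_zero (fun t => by positivity) (g := fun t : ℕ => (1 / (t : ℝ)) * R)
        (fun t => ?_) ?_
      · exact mul_le_mul_of_nonneg_left (by exact_mod_cast hbd t) (by positivity)
      · simpa using tendsto_one_div_atTop_nhds_zero_nat.mul_const (R : ℝ)
    have := tendsto_nhds_unique hlim h0
    have hq : (0 : ℝ) < I.q := by exact_mod_cast I.q_pos
    exact absurd this (by positivity)

/-! ### Cyclic assignments -/

/-- Consecutive occurrences of a task are assigned to cyclically consecutive workers. -/
def cyclic (c : ℕ → ℤ) : I.Assignment := fun i r =>
  ⟨((c i - (r : ℕ)) % I.q).toNat, by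
    have hq : (0 : ℤ) < I.q := by exact_mod_cast I.q_pos
    have h1 := Int.emod_nonneg (c i - (r : ℕ)) hq.ne'
    have h2 := Int.emod_lt_of_pos (c i - (r : ℕ)) hq
    omega⟩

theorem cyclic_coe (c : ℕ → ℤ) (i : Fin I.n) (r : ℕ+) :
    ((I.cyclic c i r : ℕ) : ℤ) = (c i - (r : ℕ)) % I.q := by
  have hq : (0 : ℤ) < I.q := by exact_mod_cast I.q_pos
  exact Int.toNat_of_nonneg (Int.emod_nonneg _ hq.ne')

/-- The offsets `c` define a feasible cyclic assignment. -/
def Valid (c : ℕ → ℤ) : Prop :=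
  ∀ (i i' : Fin I.n) (r r' : ℕ+), i ≠ i' → (I.occ i r ∩ I.occ i' r').Nonempty →
    ¬ (I.q : ℤ) ∣ (c i - (r : ℕ)) - (c i' - (r' : ℕ))

variable {I}

theorem Valid.feasible {c : ℕ → ℤ} (h : I.Valid c) : I.Feasible (I.cyclic c) := by
  intro i i' r r' hne ho e
  refine h i i' r r' hne ho ?_
  have e' := congrArg (fun x : Fin I.q => ((x : ℕ) : ℤ)) e
  simp only [cyclic_coe] at e'
  exact Int.dvd_of_emod_eq_zero (Int.emod_eq_emod_iff_emod_sub_eq_zero.1 e')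

variable (I)

theorem cyclic_hasPeriod (c : ℕ → ℤ) : I.HasPeriod (I.cyclic c) ⟨I.q, I.q_pos⟩ := by
  suffices H : ∀ h : ℕ+, (h : ℕ) = I.q → I.HasPeriod (I.cyclic c) h from H _ rfl
  intro h hh i r
  refine Fin.ext (Int.ofNat_inj.1 ?_)
  rw [cyclic_coe, cyclic_coe, Int.emod_eq_emod_iff_emod_sub_eq_zero]
  refine Int.emod_eq_zero_of_dvd ⟨1, ?_⟩
  rw [PNat.add_coe, hh]
  push_cast; ring

/-- The occurrences of `i` given to `j` form one residue class modulo `q`, and its count below `t`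
differs from `t / q` by at most one. -/
theorem cyclic_balanced (c : ℕ → ℤ) : I.Balanced (I.cyclic c) := by
  intro i j
  have hq : (0 : ℤ) < I.q := by exact_mod_cast I.q_pos
  have hqR : (0 : ℝ) < I.q := by exact_mod_cast I.q_pos
  -- This solves `c i - (k + 1) ≡ j` for `k`; the `1` is there because `k` stands for occurrence `k
  -- + 1`.
  set v : ℕ := ((c i - 1 - (j : ℕ)) % I.q).toNat with hv
  have hvc : (v : ℤ) = (c i - 1 - (j : ℕ)) % I.q :=
    Int.toNat_of_nonneg (Int.emod_nonneg _ hq.ne')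
  have hcount : ∀ t : ℕ, ((Finset.range t).filter fun k => I.cyclic c i k.succPNat = j).card =
      t.count (· ≡ v [MOD I.q]) := by
    intro t
    rw [Nat.count_eq_card_filter_range]
    congr 1
    refine Finset.filter_congr fun k _ => ?_
    have hj : ((j : ℕ) : ℤ) % I.q = (j : ℕ) :=
      Int.emod_eq_of_lt (by omega) (by exact_mod_cast j.2)
    rw [Fin.ext_iff, ← Int.ofNat_inj, cyclic_coe, ← hj, ← Int.natCast_modEq_iff, hvc,
      Nat.succPNat_coe]
    unfold Int.ModEq
    rw [Int.emod_emod_of_dvd _ dvd_rfl, Int.emod_eq_emod_iff_emod_sub_eq_zero,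
      Int.emod_eq_emod_iff_emod_sub_eq_zero, ← Int.dvd_iff_emod_eq_zero, ← Int.dvd_iff_emod_eq_zero,
      dvd_sub_comm]
    push_cast
    rw [show ((j : ℕ) : ℤ) - (c i - ((k : ℤ) + 1)) = (k : ℤ) - (c i - 1 - (j : ℕ)) by ring]
  have hbd : ∀ t : ℕ, |(t.count (· ≡ v [MOD I.q]) : ℝ) - t / I.q| ≤ 1 := by
    intro t
    have h1 := Nat.count_modEq_card_eq_ceil t I.q_pos v
    have h2 : (t.count (· ≡ v [MOD I.q]) : ℝ) = (⌈((t : ℚ) - (v % I.q : ℕ)) / I.q⌉ : ℤ) := by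
      rw [← h1]; simp
    have h3 := Int.le_ceil (((t : ℚ) - (v % I.q : ℕ)) / I.q)
    have h4 := Int.ceil_lt_add_one (((t : ℚ) - (v % I.q : ℕ)) / I.q)
    have h3' : ((t : ℝ) - (v % I.q : ℕ)) / I.q ≤ (⌈((t : ℚ) - (v % I.q : ℕ)) / I.q⌉ : ℤ) := by
      exact_mod_cast h3
    have h4' : ((⌈((t : ℚ) - (v % I.q : ℕ)) / I.q⌉ : ℤ) : ℝ) <
        ((t : ℝ) - (v % I.q : ℕ)) / I.q + 1 := by
      exact_mod_cast h4
    have h5 : ((v % I.q : ℕ) : ℝ) / I.q ≤ 1 := by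
      rw [div_le_one hqR]; exact_mod_cast (Nat.mod_lt _ I.q_pos).le
    have h6 : (0 : ℝ) ≤ ((v % I.q : ℕ) : ℝ) / I.q := by positivity
    have h7 := sub_div (t : ℝ) (v % I.q : ℕ) I.q
    rw [h2, abs_le]
    constructor <;> linarith
  simp only [hcount]
  rw [tendsto_iff_norm_sub_tendsto_zero]
  refine squeeze_zero' (Filter.Eventually.of_forall fun _ => norm_nonneg _) ?_
    tendsto_one_div_atTop_nhds_zero_nat
  filter_upwards [Filter.eventually_gt_atTop 0] with t ht
  have htR : (0 : ℝ) < t := by exact_mod_cast ht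
  have e : 1 / (t : ℝ) * (t.count (· ≡ v [MOD I.q]) : ℝ) - 1 / I.q =
      1 / (t : ℝ) * ((t.count (· ≡ v [MOD I.q]) : ℝ) - t / I.q) := by
    field_simp
  rw [e, norm_mul, Real.norm_eq_abs, Real.norm_eq_abs, abs_of_pos (by positivity)]
  exact mul_le_of_le_one_right (by positivity) (hbd t)

theorem exists_balanced_of_valid {c : ℕ → ℤ} (h : I.Valid c) :
    ∃ f : I.Assignment, I.Feasible f ∧ I.Balanced f :=
  ⟨I.cyclic c, h.feasible, I.cyclic_balanced c⟩

/-- With at least `2 n` workers, a cyclic assignment always exists. -/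
theorem valid_two_mul (hq : 2 * I.n ≤ I.q) : I.Valid (fun i => 2 * i) := by
  intro i i' r r' hne ho hd
  simp only at hd
  rw [overlap_iff] at ho
  have b1 := I.neg_one_lt_s i
  have b2 := I.neg_one_lt_s i'
  have b3 := I.e_le_one i
  have b4 := I.e_le_one i'
  have h1 : (((r : ℕ) : ℤ) : ℚ) - (((r' : ℕ) : ℤ) : ℚ) < 2 := by linarith [ho.1]
  have h2 : (((r' : ℕ) : ℤ) : ℚ) - (((r : ℕ) : ℤ) : ℚ) < 2 := by linarith [ho.2]
  have h1' : ((r : ℕ) : ℤ) - ((r' : ℕ) : ℤ) < 2 := by exact_mod_cast h1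
  have h2' : ((r' : ℕ) : ℤ) - ((r : ℕ) : ℤ) < 2 := by exact_mod_cast h2
  have hi := i.2
  have hi' := i'.2
  have hne' : (i : ℕ) ≠ i' := fun e => hne (Fin.ext e)
  -- Overlap forces `|r - r'| ≤ 1`, so `2 (i - i') - (r - r')` has absolute value at most `2 n - 1 <
  -- q`. Being divisible by `q` it would vanish, but `|2 (i - i')| ≥ 2`.
  have := Int.eq_zero_of_abs_lt_dvd hd (by rw [abs_lt]; constructor <;> omega)
  omega

end TaskInstance


/-! ### The program

The arrays: `0` the input, `1` the output, `2` the number of tasks, `3` the number of workers,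
`4` the number of endpoints, `5` the number of arcs, `6` the answer, `7`, `8`, `9` loop variables,
`10` the load, `11` the ranks of the endpoints, `12` and `13` the tails and the lengths of the arcs,
`14` a permutation of the arcs, `15` a counter of arcs, `16` the current arc of a walk, `17` a flag or
the length of a walk. -/

instance : Zero Expr := ⟨.const 0⟩
instance : One Expr := ⟨.const 1⟩
instance : Add Expr := ⟨.add⟩
instance : Sub Expr := ⟨.sub⟩
instance : Mul Expr := ⟨.mul⟩
instance : Div Expr := ⟨.div⟩

namespace Expr

variable (m : Mem) (x y : Expr)

@[simp] theorem eval_zero : (0 : Expr).eval m = 0 := rfl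
@[simp] theorem eval_one : (1 : Expr).eval m = 1 := rfl
@[simp] theorem eval_add : (x + y).eval m = x.eval m + y.eval m := rfl
@[simp] theorem eval_sub : (x - y).eval m = x.eval m - y.eval m := rfl
@[simp] theorem eval_mul : (x * y).eval m = x.eval m * y.eval m := rfl
@[simp] theorem eval_div : (x / y).eval m = x.eval m / y.eval m := rfl
@[simp] theorem eval_cell (a : ℕ) : (cell a x).eval m = m a (x.eval m).toNat := rfl
@[simp] theorem eval_const (c : ℤ) : (const c).eval m = c := rfl

/-- The indicator of divisibility by the value of variable `4`. -/
def dvdInd (e : Expr) : Expr := e / var 4 - (e - 1) / var 4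

@[simp] theorem eval_dvdInd : x.dvdInd.eval m = BalancedTasks.dvdInd (m 4 0) (x.eval m) := rfl

/-- The numerator of an endpoint. -/
def num (u : Expr) : Expr := cell 0 (1 + 1 + 1 + (u + u))

/-- The denominator of an endpoint. -/
def den (u : Expr) : Expr := cell 0 (1 + 1 + 1 + 1 + (u + u))

/-- The head of an arc. -/
def head (a : Expr) : Expr := cell 12 a + cell 13 a

end Expr

namespace LProg

@[simp] theorem den_skip (m : Mem) : LProg.skip.den m = m := rfl
@[simp] theorem den_seq (c d : LProg) (m : Mem) : (LProg.seq c d).den m = d.den (c.den m) := rfl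
theorem den_ite (b : Expr) (c d : LProg) (m : Mem) :
    (LProg.ite b c d).den m = if 0 < b.eval m then c.den m else d.den m := rfl
@[simp] theorem den_store (a : ℕ) (idx val : Expr) (m : Mem) :
    (LProg.store a idx val).den m = m.put a (idx.eval m).toNat (val.eval m) := rfl

/-- Case distinction according to whether two values differ. -/
def ifNe (x y : Expr) (c d : LProg) : LProg := .ite (x - y) c (.ite (y - x) c d)

theorem den_ifNe (x y : Expr) (c d : LProg) (m : Mem) :
    (ifNe x y c d).den m = if x.eval m = y.eval m then d.den m else c.den m := by
  have h1 : (x - y).eval m = x.eval m - y.eval m := rfl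
  have h2 : (y - x).eval m = y.eval m - x.eval m := rfl
  rw [ifNe, den_ite, den_ite]
  split_ifs <;> first | rfl | omega

open BalancedTasks.Expr Equiv

/-- Reading the parameters. -/
def setup : LProg :=
  .seq (set 2 (cell 0 1)) <| .seq (set 3 (cell 0 (1 + 1))) <| .seq (set 4 (var 2 + var 2)) <|
  set 5 (cell 0 1 + (cell 0 1 + cell 0 1) * cell 0 (1 + 1))

/-- Offsets for many workers. -/
def easy : LProg :=
  .seq (set 6 1) <| iter 7 2 (.store 1 (var 7 + 1) (var 7 + var 7))

/-- Computing the ranks of the endpoints. -/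
def ranks : LProg :=
  iter 7 4 <| .seq (.store 11 (var 7) 0) <|
    iter 8 4 (.store 11 (var 7) (cell 11 (var 7) -
      ((var 8).num * (var 7).den - (var 7).num * (var 8).den) / ((var 8).den * (var 7).den)))

/-- The arcs of the tasks. -/
def taskArcs : LProg :=
  iter 7 2 <| .seq (.store 12 (var 7) (cell 11 (var 7 + var 7))) <|
    .store 13 (var 7) (cell 11 (var 7 + var 7 + 1) - cell 11 (var 7 + var 7))

/-- Computing the load. -/
def loadProg : LProg :=
  .seq (set 10 0) <| iter 8 2 <| set 10 (var 10 +
    ((cell 11 (var 8 + var 8 + 1) - 1 - var 7) / var 4 -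
      (cell 11 (var 8 + var 8) - 1 - var 7) / var 4))

/-- The idle arcs from one vertex. -/
def idleArcsAt : LProg :=
  iter 8 3 <| .seq (.store 12 (var 15) (var 7)) <|
    .seq (.ite (var 3 - var 10 - var 8) (.store 13 (var 15) 1) (.store 13 (var 15) 0)) <|
    set 15 (var 15 + 1)

/-- The idle arcs. -/
def idleArcs : LProg :=
  .seq (set 15 (var 2)) <| .seq (set 6 1) <|
  iter 7 4 <| .seq loadProg <| .seq (.ite (var 10 - var 3) (set 6 0) .skip) idleArcsAt

/-- Initializing the permutation. -/
def identity : LProg := iter 7 5 (.store 14 (var 7) (var 7))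

/-- Exchanging two entries of the permutation. -/
def exchange : LProg :=
  .seq (set 16 (cell 14 (var 7))) <| .seq (.store 14 (var 7) (cell 14 (var 8))) <|
  .store 14 (var 8) (var 16)

/-- Making successive arcs adjacent. -/
def matching : LProg :=
  iter 7 5 <| iter 8 5 <| .ite (var 8 - var 7)
    (.ite ((head (var 7) - cell 12 (cell 14 (var 8))).dvdInd -
      (head (var 7) - cell 12 (cell 14 (var 7))).dvdInd) exchange .skip) .skip

/-- Testing whether two arcs are in different cycles. -/
def search : LProg :=
  .seq (set 16 (var 7)) <| .seq (set 17 1) <|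
  iter 9 5 <| .seq (ifNe (var 16) (var 8) .skip (set 17 0)) <| set 16 (cell 14 (var 16))

/-- Merging cycles. -/
def merging : LProg :=
  iter 7 5 <| iter 8 5 <| .seq search <|
    .ite ((head (var 7) - head (var 8)).dvdInd + var 17 - 1) exchange .skip

/-- Walking from the first arc to arc `7`. -/
def walk : LProg :=
  .seq (set 16 0) <| .seq (set 17 (cell 12 0)) <|
  iter 9 5 <| ifNe (var 16) (var 7)
    (.seq (set 17 (var 17 + cell 13 (var 16))) <| set 16 (cell 14 (var 16))) .skip

/-- Computing the offsets. -/
def offsets : LProg :=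
  iter 7 2 <| .seq walk <| .seq (ifNe (var 16) (var 7) (set 6 0) .skip) <|
    .store 1 (var 7 + 1) ((var 17 - cell 12 (var 7)) / var 4)

/-- Offsets for few workers. -/
def hard : LProg :=
  .seq ranks <| .seq taskArcs <| .seq idleArcs <| .seq identity <| .seq matching <|
  .seq merging offsets

/-- The common part of both algorithms. -/
def main : LProg := .seq setup <| .ite (var 3 + 1 - var 4) easy hard

/-- The decision algorithm. -/
def decider : LProg := .seq main <| .seq (.store 1 1 (var 6)) <| .store 1 0 1

/-- The algorithm that computes a description. -/
def solver : LProg := .seq main <| .store 1 0 (var 2)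

/-- The algorithm that evaluates a description. -/
def evaluator : LProg :=
  .seq (.store 1 1 (cell 0 (1 + 1 + 1 + 1 + cell 0 (1 + 1)) - cell 0 (1 + 1 + 1) -
    cell 0 1 * ((cell 0 (1 + 1 + 1 + 1 + cell 0 (1 + 1)) - cell 0 (1 + 1 + 1)) / cell 0 1))) <|
  .store 1 0 1

theorem decider_wf : decider.wf := by decide
theorem solver_wf : solver.wf := by decide
theorem evaluator_wf : evaluator.wf := by decide

/-! ### Correctness of the parts -/

theorem toNat_three_add (u : ℕ) : (1 + 1 + 1 + ((u : ℤ) + u)).toNat = 3 + 2 * u := by omega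
theorem toNat_four_add (u : ℕ) : (1 + 1 + 1 + 1 + ((u : ℤ) + u)).toNat = 4 + 2 * u := by omega

/-- A ceiling is a negated floor, here of an integer quotient. This is the form evaluated by
`ranks`, whose products involve only input cells. -/
theorem ceil_sub_eq (x y : ℚ) :
    ⌈x - y⌉ = -((y.num * x.den - x.num * y.den) / ((y.den : ℤ) * x.den)) := by
  have h : y - x = ((y.num * x.den - x.num * y.den : ℤ) : ℚ) / ((y.den * x.den : ℕ) : ℚ) := by
    have hx : (x.den : ℚ) ≠ 0 := by exact_mod_cast x.den_ne_zero
    have hy : (y.den : ℚ) ≠ 0 := by exact_mod_cast y.den_ne_zero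
    conv_lhs => rw [← Rat.num_div_den x, ← Rat.num_div_den y]
    push_cast
    field_simp
  rw [← neg_sub, Int.ceil_neg, h, Rat.floor_intCast_div_natCast]
  push_cast; rfl

theorem ranks_spec (I : TaskInstance) (m : Mem) (h4 : m 4 0 = (2 * I.n : ℕ))
    (hnum : ∀ u < 2 * I.n, m 0 (3 + 2 * u) = (I.endpoint u).num)
    (hden : ∀ u < 2 * I.n, m 0 (4 + 2 * u) = (I.endpoint u).den) :
    ∀ u < 2 * I.n, ranks.den m 11 u = I.rank (I.endpoint u) := by
  refine den_iter_induction (by decide) (2 * I.n) h4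
    (fun k s => ∀ u < k, s 11 u = I.rank (I.endpoint u)) (by simp) ?_
  intro k hk s hs h7 hfr
  have hk' := den_iter_induction (m := (store 11 (var 7) 0).den s) (v := 8) (h := 4)
    (c := .store 11 (var 7) (cell 11 (var 7) -
      ((var 8).num * (var 7).den - (var 7).num * (var 8).den) / ((var 8).den * (var 7).den)))
    (by decide) (2 * I.n) (by
      rw [den_frame _ _ (by decide), hfr 4 (by decide), h4])
    (fun l s' => (∀ u < k, s' 11 u = I.rank (I.endpoint u)) ∧
      s' 11 k = ∑ v ∈ Finset.range l, ⌈I.endpoint k - I.endpoint v⌉) ?_ ?_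
  · intro u hu
    rw [Mem.put_ne _ _ _ (by decide), den_seq]
    rcases Nat.lt_succ_iff_lt_or_eq.1 hu with hu | rfl
    · exact hk'.1 u hu
    · exact hk'.2
  · simp only [Mem.put_apply, den_store, eval_cell, eval_const, Int.toNat_zero, eval_zero, h7]
    refine ⟨fun u hu => ?_, by simp⟩
    simp [hu.ne, hs u hu]
  · rintro l hl s' ⟨h1, h2⟩ h8 hfr'
    have h7' : s' 7 0 = k := by
      rw [hfr' 7 (by decide), den_frame _ _ (by decide), h7]
    have h0 : s' 0 = m 0 := by
      rw [hfr' 0 (by decide), den_frame _ _ (by decide), hfr 0 (by decide)]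
    simp only [Mem.put_apply, den_store, eval_const, Int.toNat_zero, eval_sub, eval_div, eval_mul, eval_cell, Expr.num,
      Expr.den, eval_add, eval_one, h7', h8, Int.toNat_natCast, h2, h0, toNat_three_add,
      toNat_four_add, hnum l hl, hnum k hk, hden l hl, hden k hk]
    refine ⟨fun u hu => ?_, ?_⟩
    · simp [hu.ne, h1 u hu]
    · rw [Finset.sum_range_succ, ceil_sub_eq]
      simp [sub_eq_add_neg]


theorem taskArcs_spec {n : ℕ} {R : ℕ → ℤ} (m : Mem) (h2 : m 2 0 = n)
    (h11 : ∀ u < 2 * n, m 11 u = R u) : ∀ i < n, taskArcs.den m 12 i = R (2 * i) ∧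
      taskArcs.den m 13 i = R (2 * i + 1) - R (2 * i) := by
  refine den_iter_induction (by decide) n h2
    (fun k s => ∀ i < k, s 12 i = R (2 * i) ∧ s 13 i = R (2 * i + 1) - R (2 * i)) (by simp) ?_
  intro k hk s hs h7 hfr i hi
  have e1 : ((k : ℤ) + k).toNat = 2 * k := by omega
  have e2 : ((k : ℤ) + k + 1).toNat = 2 * k + 1 := by omega
  simp only [Mem.put_apply, den_seq, den_store, eval_cell, eval_const, Int.toNat_zero, eval_add,
    eval_sub, eval_one, h7, hfr 11 (by decide), e1, Int.toNat_natCast]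
  rcases Nat.lt_succ_iff_lt_or_eq.1 hi with hi | rfl
  · simp [hi.ne, hs i hi]
  · simp [e1, e2, h11 (2 * i) (by omega), h11 (2 * i + 1) (by omega)]

theorem loadProg_spec {n : ℕ} {M t : ℤ} {R : ℕ → ℤ} (m : Mem) (h2 : m 2 0 = n) (h4 : m 4 0 = M)
    (h7 : m 7 0 = t) (h11 : ∀ u < 2 * n, m 11 u = R u) :
    loadProg.den m 10 0 = load n M (fun i => R (2 * i)) (fun i => R (2 * i + 1)) t := by
  rw [loadProg, den_seq]
  refine den_iter_induction (by decide) n (by rw [den_frame _ _ (by decide), h2])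
    (fun k s => s 10 0 = ∑ i ∈ Finset.range k, cov M (R (2 * i)) (R (2 * i + 1)) t)
    (by simp [Mem.put_apply]) ?_
  intro k hk s hs h8 hfr
  have e1 : ((k : ℤ) + k).toNat = 2 * k := by omega
  have e2 : ((k : ℤ) + k + 1).toNat = 2 * k + 1 := by omega
  have f4 : s 4 = m 4 := by rw [hfr 4 (by decide), den_frame _ _ (by decide)]
  have f7 : s 7 = m 7 := by rw [hfr 7 (by decide), den_frame _ _ (by decide)]
  have f11 : s 11 = m 11 := by rw [hfr 11 (by decide), den_frame _ _ (by decide)]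
  simp [Mem.put_apply, h8, e1, e2, f4, f7, f11, h4, h7, hs, h11 (2 * k) (by omega),
    h11 (2 * k + 1) (by omega), Finset.sum_range_succ, cov]
  ring

theorem idleArcsAt_spec {q c : ℕ} {t l : ℤ} (m : Mem) (h3 : m 3 0 = q) (h7 : m 7 0 = t)
    (h10 : m 10 0 = l) (h15 : m 15 0 = c) :
    idleArcsAt.den m 15 0 = (c + q : ℕ) ∧
    (∀ x < c, idleArcsAt.den m 12 x = m 12 x ∧ idleArcsAt.den m 13 x = m 13 x) ∧
    ∀ k < q, idleArcsAt.den m 12 (c + k) = t ∧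
      idleArcsAt.den m 13 (c + k) = if l + k < q then 1 else 0 := by
  refine den_iter_induction (by decide) q h3 (fun j s => s 15 0 = (c + j : ℕ) ∧
    (∀ x < c, s 12 x = m 12 x ∧ s 13 x = m 13 x) ∧
    ∀ k < j, s 12 (c + k) = t ∧ s 13 (c + k) = if l + k < q then 1 else 0)
    (by simp [Mem.put_apply, h15]) ?_
  rintro j hj s ⟨hs1, hs2, hs3⟩ h8 hfr
  have e0 : ((c : ℤ) + j).toNat = c + j := by omega
  have f3 := hfr 3 (by decide)
  have f7 := hfr 7 (by decide)
  have f10 := hfr 10 (by decide)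
  rw [den_seq, den_seq]
  set s₁ := (store 12 (var 15) (var 7)).den s with hs₁
  have e₁ : ∀ a x, s₁ a x = if a = 12 ∧ x = c + j then t else s a x := by
    intro a x
    simp [hs₁, Mem.put_apply, hs1, f7, h7, e0]
  have e₂ : (ite (var 3 - var 10 - var 8) (.store 13 (var 15) 1) (.store 13 (var 15) 0)).den s₁ =
      s₁.put 13 (c + j) (if l + j < q then 1 else 0) := by
    have b : (var 3 - var 10 - var 8).eval s₁ = q - l - j := by
      simp [e₁, f3, f10, h3, h10, h8]
    rw [den_ite, b]
    split_ifs <;> first | omega | simp [e₁, hs1, e0]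
  rw [e₂]
  refine ⟨?_, fun x hx => ?_, fun k hk => ?_⟩
  · simp [Mem.put_apply, e₁, hs1]; ring
  · have h1 := hs2 x hx
    have h2 : x ≠ c + j := by omega
    simp [Mem.put_apply, e₁, h1, h2]
  · rcases Nat.lt_succ_iff_lt_or_eq.1 hk with hk | rfl
    · have h1 := hs3 k hk
      have h2 : k ≠ j := hk.ne
      simp [Mem.put_apply, e₁, h1, h2]
    · simp [Mem.put_apply, e₁]

/-- The arcs are written even if the load exceeds `q` somewhere; variable `6` records whether it
does. -/
theorem idleArcs_spec {n q M : ℕ} {R : ℕ → ℤ} (m : Mem) (h2 : m 2 0 = n) (h3 : m 3 0 = q)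
    (h4 : m 4 0 = M) (h11 : ∀ u < 2 * n, m 11 u = R u)
    (h12 : ∀ i < n, m 12 i = R (2 * i) ∧ m 13 i = R (2 * i + 1) - R (2 * i)) :
    IsArcs n q M (fun i => R (2 * i)) (fun i => R (2 * i + 1)) (idleArcs.den m 12)
      (idleArcs.den m 13) ∧
    (idleArcs.den m 6 0 = 0 ∨ idleArcs.den m 6 0 = 1) ∧
    (idleArcs.den m 6 0 = 1 ↔
      ∀ t < M, load n M (fun i => R (2 * i)) (fun i => R (2 * i + 1)) (t : ℕ) ≤ q) := by
  set ld := load n M (fun i => R (2 * i)) (fun i => R (2 * i + 1)) with hld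
  have main := den_iter_induction (v := 7) (h := 4) (m := (set 6 1).den ((set 15 (var 2)).den m))
    (c := .seq loadProg (.seq (.ite (var 10 - var 3) (set 6 0) .skip) idleArcsAt)) (by decide) M
    (by rw [den_frame _ _ (by decide), den_frame _ _ (by decide), h4])
    (fun k s => s 15 0 = (n + k * q : ℕ) ∧ (∀ i < n, s 12 i = m 12 i ∧ s 13 i = m 13 i) ∧
      (∀ t < k, ∀ j < q, s 12 (n + t * q + j) = t ∧
        s 13 (n + t * q + j) = if ld t + j < q then 1 else 0) ∧
      (s 6 0 = 0 ∨ s 6 0 = 1) ∧ (s 6 0 = 1 ↔ ∀ t < k, ld (t : ℕ) ≤ q))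
    (by simp [Mem.put_apply, h2]) ?_
  · obtain ⟨-, a2, a3, a4, a5⟩ := main
    refine ⟨⟨fun i hi => ?_, fun i hi => ?_, fun t ht k hk => (a3 t ht k hk).1,
      fun t ht k hk => (a3 t ht k hk).2⟩, a4, a5⟩
    · exact (a2 i hi).1.trans (h12 i hi).1
    · exact (a2 i hi).2.trans (h12 i hi).2
  · rintro k hk s ⟨a1, a2, a3, a4, a5⟩ h7 hfr
    have fr : ∀ a, a ∉ 7 :: (LProg.seq loadProg (.seq (.ite (var 10 - var 3) (set 6 0) .skip)
        idleArcsAt)).writes → a ∉ (set 6 1).writes → a ∉ (set 15 (var 2)).writes → s a = m a :=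
      fun a b1 b2 b3 => by rw [hfr a b1, den_frame _ _ b2, den_frame _ _ b3]
    rw [den_seq, den_seq]
    set s₁ := loadProg.den s with hs₁
    have f₁ : ∀ a, a ∉ loadProg.writes → s₁ a = s a := fun a ha => den_frame _ _ ha
    have l₁ : s₁ 10 0 = ld k := loadProg_spec s
      (by rw [fr 2 (by decide) (by decide) (by decide), h2])
      (by rw [fr 4 (by decide) (by decide) (by decide), h4]) h7
      (by rw [fr 11 (by decide) (by decide) (by decide)]; exact h11)
    have q₁ : s₁ 3 0 = q := by
      rw [f₁ 3 (by decide), fr 3 (by decide) (by decide) (by decide), h3]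
    set s₂ := (LProg.ite (var 10 - var 3) (set 6 0) .skip).den s₁ with hs₂
    have f₂ : ∀ a, a ∉ (LProg.ite (var 10 - var 3) (set 6 0) .skip).writes → s₂ a = s₁ a :=
      fun a ha => den_frame _ _ ha
    have ok₂ : s₂ 6 0 = if ld k ≤ q then s 6 0 else 0 := by
      have b : (var 10 - var 3).eval s₁ = ld k - q := by simp [l₁, q₁]
      rw [hs₂, den_ite, b]
      split_ifs <;> first | omega | simp [Mem.put_apply, f₁ 6 (by decide)]
    obtain ⟨b1, b2, b3⟩ := idleArcsAt_spec (q := q) (c := n + k * q) (t := k) (l := ld k) s₂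
      (by rw [f₂ 3 (by decide), q₁])
      (by rw [f₂ 7 (by decide), f₁ 7 (by decide), h7])
      (by rw [f₂ 10 (by decide), l₁])
      (by rw [f₂ 15 (by decide), f₁ 15 (by decide), a1])
    have f₃ : idleArcsAt.den s₂ 6 = s₂ 6 := den_frame _ _ (by decide)
    have e12 : s₂ 12 = s 12 := by rw [f₂ 12 (by decide), f₁ 12 (by decide)]
    have e13 : s₂ 13 = s 13 := by rw [f₂ 13 (by decide), f₁ 13 (by decide)]
    rw [e12, e13] at b2
    simp only [Mem.put_ne _ _ _ (show 15 ≠ 7 by decide), Mem.put_ne _ _ _ (show 12 ≠ 7 by decide),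
      Mem.put_ne _ _ _ (show 13 ≠ 7 by decide), Mem.put_ne _ _ _ (show 6 ≠ 7 by decide), f₃, ok₂]
    refine ⟨?_, fun i hi => ?_, fun t ht j hj => ?_, ?_, ?_⟩
    · rw [b1]; push_cast; ring
    · have := b2 i (by omega)
      rw [this.1, this.2]; exact a2 i hi
    · rcases Nat.lt_succ_iff_lt_or_eq.1 ht with ht | rfl
      · have hlt : n + t * q + j < n + k * q := by
          have := Nat.mul_le_mul_right q (show t + 1 ≤ k from ht)
          rw [Nat.succ_mul] at this; omega
        rw [(b2 _ hlt).1, (b2 _ hlt).2]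
        exact a3 t ht j hj
      · exact b3 j hj
    · split_ifs
      · exact a4
      · exact .inl rfl
    · split_ifs with hq
      · rw [a5, Nat.forall_lt_succ_right]; simp [hq]
      · simp only [zero_ne_one, false_iff, not_forall]
        exact ⟨k, Nat.lt_succ_self k, hq⟩

/-! ### The permutation -/

/-- Array `14` holds the permutation `σ`. -/
def Holds {A : ℕ} (m : Mem) (σ : Perm (Fin A)) : Prop := ∀ x : Fin A, m 14 x = (σ x : ℕ)

theorem identity_spec {A : ℕ} (m : Mem) (h5 : m 5 0 = A) :
    Holds (identity.den m) (1 : Perm (Fin A)) := by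
  have := den_iter_induction (v := 7) (h := 5) (m := m) (c := .store 14 (var 7) (var 7)) (by decide)
    A h5 (fun k s => ∀ x < k, s 14 x = (x : ℕ)) (by simp) (by
      intro k hk s hs h7 _ x hx
      rcases Nat.lt_succ_iff_lt_or_eq.1 hx with hx | rfl
      · simp [Mem.put_apply, h7, hx.ne, hs x hx]
      · simp [Mem.put_apply, h7])
  exact fun x => this x x.2

theorem exchange_spec {A : ℕ} {σ : Perm (Fin A)} {m : Mem} (h : Holds m σ) {a b : Fin A}
    (h7 : m 7 0 = (a : ℕ)) (h8 : m 8 0 = (b : ℕ)) : Holds (exchange.den m) (σ * swap a b) := by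
  intro x
  simp only [exchange, den_seq, den_store, Mem.put_apply, eval_cell, eval_const, Int.toNat_zero, h7,
    h8, Int.toNat_natCast, h a, h x]
  by_cases hb : x = b
  · simp [hb]
  · by_cases ha : x = a
    · have : ¬ ((a : ℕ) = (b : ℕ)) := fun e => hb (ha.trans (Fin.ext e))
      subst ha
      simp [this, h b]
    · have h1 : ¬ ((x : ℕ) = (b : ℕ)) := fun e => hb (Fin.ext e)
      have h2 : ¬ ((x : ℕ) = (a : ℕ)) := fun e => ha (Fin.ext e)
      simp [h1, h2, swap_apply_of_ne_of_ne ha hb]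

/-- Count heads and tails at the vertex `v` where `a` ends. For `x < a` the head of `x` and the tail
of `σ x` agree modulo `M`. If no `σ b` with `b ≥ a` started at `v`, the head of `a` would make the
heads at `v` outnumber the tails. -/
theorem exists_unmatched {A : ℕ} {M : ℤ} (hM : 0 < M) {tl ln : ℕ → ℤ} {σ : Perm (Fin A)}
    (hbal : ∀ v, ∑ x : Fin A, dvdInd M (tl x + ln x - v) = ∑ x : Fin A, dvdInd M (tl x - v))
    {a : Fin A} (ha : ∀ x < a, M ∣ tl x + ln x - tl (σ x)) :
    ∃ b, a ≤ b ∧ M ∣ tl a + ln a - tl (σ b) := by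
  by_contra! hcon
  have h := hbal (tl a + ln a)
  rw [← Equiv.sum_comp σ (fun x => dvdInd M (tl x - (tl a + ln a)))] at h
  refine absurd h (ne_of_gt (Finset.sum_lt_sum (fun x _ => ?_) ⟨a, Finset.mem_univ _, ?_⟩))
  · rcases lt_or_ge x a with hx | hx
    · refine (dvdInd_congr hM ?_).ge
      have := ha x hx
      rwa [sub_sub_sub_cancel_right]
    · rw [dvdInd_eq hM (tl (σ x) - _), if_neg (by rw [dvd_sub_comm]; exact hcon x hx)]
      exact dvdInd_nonneg hM _
  · rw [dvdInd_eq hM (tl (σ a) - _), if_neg (by rw [dvd_sub_comm]; exact hcon a le_rfl), sub_self,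
      dvdInd_eq hM, if_pos (dvd_zero M)]
    exact zero_lt_one

/-- As in selection sort, the successor of arc `k` is fetched from a later position without touching
the earlier ones. Balance is only a premise of the conclusion because the loop also runs when the
load exceeds `q`. -/
theorem matching_spec {A M : ℕ} (hM : 0 < M) {σ₀ : Perm (Fin A)} {tl ln : ℕ → ℤ} (m : Mem)
    (h4 : m 4 0 = M) (h5 : m 5 0 = A) (h12 : m 12 = tl) (h13 : m 13 = ln) (h14 : Holds m σ₀) :
    ∃ σ : Perm (Fin A), Holds (matching.den m) σ ∧
      ((∀ v, ∑ x : Fin A, dvdInd M (tl x + ln x - v) = ∑ x : Fin A, dvdInd M (tl x - v)) →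
        ∀ x : Fin A, (M : ℤ) ∣ tl x + ln x - tl (σ x)) := by
  have hM' : (0 : ℤ) < M := by exact_mod_cast hM
  generalize hB : (∀ v, ∑ x : Fin A, dvdInd M (tl x + ln x - v) =
    ∑ x : Fin A, dvdInd M (tl x - v)) = Bal
  -- The redundant `x < A` gives the goal the shape of the loop invariant at the final counter
  -- value.
  suffices H : ∃ σ : Perm (Fin A), Holds (matching.den m) σ ∧
      (Bal → ∀ x : Fin A, (x : ℕ) < A → (M : ℤ) ∣ tl x + ln x - tl (σ x)) by
    obtain ⟨σ, h1, h2⟩ := H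
    exact ⟨σ, h1, fun hb x => h2 hb x x.2⟩
  refine den_iter_induction (by decide) A h5 (fun k s => ∃ σ : Perm (Fin A), Holds s σ ∧
      (Bal → ∀ x : Fin A, (x : ℕ) < k → (M : ℤ) ∣ tl x + ln x - tl (σ x)))
      ⟨σ₀, fun x => by rw [Mem.put_ne _ _ _ (by decide)]; exact h14 x, by simp⟩ ?_
  rintro k hk s ⟨σ, hσ, hmat⟩ h7 hfr
  -- Either arc `k` already has a fitting successor, or one is still ahead at a position `b ≥ l`. At
  -- `l = A` only the first is possible.
  have inner := den_iter_induction (v := 8) (h := 5) (m := s) (c := .ite (var 8 - var 7)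
    (.ite ((head (var 7) - cell 12 (cell 14 (var 8))).dvdInd -
      (head (var 7) - cell 12 (cell 14 (var 7))).dvdInd) exchange .skip) .skip) (by decide) A
    (by rw [hfr 5 (by decide), h5])
    (fun l s => ∃ σ : Perm (Fin A), Holds s σ ∧
      (Bal → ∀ x : Fin A, (x : ℕ) < k → (M : ℤ) ∣ tl x + ln x - tl (σ x)) ∧
      (Bal → (M : ℤ) ∣ tl k + ln k - tl (σ ⟨k, hk⟩) ∨
        ∃ b : Fin A, k < b ∧ l ≤ b ∧ (M : ℤ) ∣ tl k + ln k - tl (σ b))) ?_ ?_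
  · obtain ⟨σ', c1, c2, c3⟩ := inner
    refine ⟨σ', fun x => by rw [Mem.put_ne _ _ _ (by decide)]; exact c1 x, fun hb x hx => ?_⟩
    rcases Nat.lt_succ_iff_lt_or_eq.1 hx with hx | hx
    · exact c2 hb x hx
    · have hx' : x = ⟨k, hk⟩ := Fin.ext hx
      rcases c3 hb with h | ⟨b, -, hb, -⟩
      · rw [hx']; exact h
      · exact absurd b.2 (by omega)
  · refine ⟨σ, fun x => by rw [Mem.put_ne _ _ _ (by decide)]; exact hσ x, hmat, fun hb => ?_⟩
    have hb' := hb
    rw [← hB] at hb'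
    obtain ⟨b, h1, h2⟩ := exists_unmatched hM' (a := ⟨k, hk⟩) (σ := σ) hb'
      (fun x hx => hmat hb x hx)
    rcases eq_or_lt_of_le h1 with h | h
    · left; rw [h]; exact h2
    · exact .inr ⟨b, h, Nat.zero_le _, h2⟩
  · rintro l hl s' ⟨σ', c1, c2, c3⟩ h8 hfr'
    have f7 : s' 7 0 = k := by rw [hfr' 7 (by decide), h7]
    have f12 : s' 12 = tl := by rw [hfr' 12 (by decide), hfr 12 (by decide), h12]
    have f13 : s' 13 = ln := by rw [hfr' 13 (by decide), hfr 13 (by decide), h13]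
    have f4 : s' 4 0 = M := by rw [hfr' 4 (by decide), hfr 4 (by decide), h4]
    have ck : s' 14 k = (σ' ⟨k, hk⟩ : ℕ) := c1 ⟨k, hk⟩
    have cl : s' 14 l = (σ' ⟨l, hl⟩ : ℕ) := c1 ⟨l, hl⟩
    have b1 : (var 8 - var 7).eval s' = l - k := by simp [h8, f7]
    have b2 : ((head (var 7) - cell 12 (cell 14 (var 8))).dvdInd -
        (head (var 7) - cell 12 (cell 14 (var 7))).dvdInd).eval s' =
        dvdInd M (tl k + ln k - tl (σ' ⟨l, hl⟩)) - dvdInd M (tl k + ln k - tl (σ' ⟨k, hk⟩)) := by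
      simp [head, f4, f7, f12, f13, h8, ck, cl]
    suffices H : ∃ σ : Perm (Fin A), Holds ((LProg.ite (var 8 - var 7)
        (.ite ((head (var 7) - cell 12 (cell 14 (var 8))).dvdInd -
        (head (var 7) - cell 12 (cell 14 (var 7))).dvdInd) exchange .skip) .skip).den s') σ ∧
        (Bal → ∀ x : Fin A, (x : ℕ) < k → (M : ℤ) ∣ tl x + ln x - tl (σ x)) ∧
        (Bal → (M : ℤ) ∣ tl k + ln k - tl (σ ⟨k, hk⟩) ∨
          ∃ b : Fin A, k < b ∧ l + 1 ≤ b ∧ (M : ℤ) ∣ tl k + ln k - tl (σ b)) by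
      obtain ⟨τ, d1, d2⟩ := H
      exact ⟨τ, fun x => by rw [Mem.put_ne _ _ _ (by decide)]; exact d1 x, d2⟩
    rw [den_ite, b1, den_ite, b2, dvdInd_eq hM', dvdInd_eq hM']
    by_cases hkl : k < l
    · rw [if_pos (by omega)]
      by_cases hsw : (M : ℤ) ∣ tl k + ln k - tl (σ' ⟨l, hl⟩) ∧
          ¬ (M : ℤ) ∣ tl k + ln k - tl (σ' ⟨k, hk⟩)
      · rw [if_pos hsw.1, if_neg hsw.2, if_pos (by norm_num)]
        refine ⟨_, exchange_spec c1 (a := ⟨k, hk⟩) (b := ⟨l, hl⟩) f7 h8, fun hb x hx => ?_,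
          fun hb => .inl (by simpa using hsw.1)⟩
        have hxk : x ≠ ⟨k, hk⟩ := fun e => by rw [e] at hx; exact lt_irrefl _ hx
        have hxl : x ≠ ⟨l, hl⟩ := fun e => by rw [e] at hx; exact absurd hx (by simp; omega)
        rw [Perm.mul_apply, swap_apply_of_ne_of_ne hxk hxl]
        exact c2 hb x hx
      · have : ¬ (0 : ℤ) < (if (M : ℤ) ∣ tl k + ln k - tl (σ' ⟨l, hl⟩) then 1 else 0) -
            (if (M : ℤ) ∣ tl k + ln k - tl (σ' ⟨k, hk⟩) then 1 else 0) := by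
          split_ifs <;> omega
        rw [if_neg this]
        refine ⟨σ', c1, c2, fun hb => ?_⟩
        rcases c3 hb with h | ⟨b, e1, e2, e3⟩
        · exact .inl h
        · rcases eq_or_lt_of_le e2 with rfl | e2
          · left; by_contra hn; exact hsw ⟨e3, hn⟩
          · exact .inr ⟨b, e1, e2, e3⟩
    · rw [if_neg (by omega)]
      refine ⟨σ', c1, c2, fun hb => ?_⟩
      rcases c3 hb with h | ⟨b, e1, e2, e3⟩
      · exact .inl h
      · exact .inr ⟨b, e1, by omega, e3⟩

/-- The points visited up to and including the first hit are distinct elements of `Fin A`. -/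
theorem exists_firstHit {A : ℕ} {σ : Perm (Fin A)} {o b : Fin A} (h : σ.SameCycle o b) :
    ∃ k < A, FirstHit σ o b k := by
  classical
  have hex := h.exists_nat_pow_eq
  have hk : FirstHit σ o b (Nat.find hex) := ⟨Nat.find_spec hex, fun l hl => Nat.find_min hex hl⟩
  refine ⟨Nat.find hex, ?_, hk⟩
  have inj : Function.Injective fun l : Fin (Nat.find hex + 1) => (σ ^ (l : ℕ)) o := by
    intro l l' e
    rcases lt_trichotomy (l : ℕ) l' with h | h | h
    · exact absurd e (pow_apply_ne_of_first hk.1 hk.2 (by omega) h)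
    · exact Fin.ext h
    · exact absurd e.symm (pow_apply_ne_of_first hk.1 hk.2 (by omega) h)
  have := Fintype.card_le_of_injective _ inj
  simpa using this

/-- A hit, if any, occurs in fewer than `A` steps, so `A` iterations decide. The walk continues
after a hit; the flag, once cleared, stays cleared. -/
theorem search_spec {A : ℕ} {σ : Perm (Fin A)} {m : Mem} (h5 : m 5 0 = A) (h14 : Holds m σ)
    {a b : Fin A} (h7 : m 7 0 = (a : ℕ)) (h8 : m 8 0 = (b : ℕ)) :
    (search.den m 17 0 = 0 ∧ σ.SameCycle a b) ∨ (search.den m 17 0 = 1 ∧ ¬ σ.SameCycle a b) := by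
  have main := den_iter_induction (v := 9) (h := 5) (m := (set 17 1).den ((set 16 (var 7)).den m))
    (c := .seq (ifNe (var 16) (var 8) .skip (set 17 0)) (set 16 (cell 14 (var 16)))) (by decide) A
    (by rw [den_frame _ _ (by decide), den_frame _ _ (by decide), h5])
    (fun j s => s 16 0 = ((σ ^ j) a : Fin A) ∧ ((s 17 0 = 0 ∧ σ.SameCycle a b) ∨
      (s 17 0 = 1 ∧ ∀ l < j, (σ ^ l) a ≠ b))) (by simp [Mem.put_apply, h7]) ?_
  · obtain ⟨-, h⟩ := main
    rcases h with h | ⟨h, hn⟩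
    · exact .inl h
    · refine .inr ⟨h, fun hs => ?_⟩
      obtain ⟨k, hk, hit⟩ := exists_firstHit hs
      exact hn k hk hit.1
  · rintro j hj s ⟨h16, h17⟩ h9 hfr
    have f8 : s 8 0 = (b : ℕ) := by
      rw [hfr 8 (by decide), den_frame _ _ (by decide), den_frame _ _ (by decide), h8]
    have f14 : s 14 = m 14 := by
      rw [hfr 14 (by decide), den_frame _ _ (by decide), den_frame _ _ (by decide)]
    have e : s 14 ((σ ^ j) a : Fin A) = ((σ ^ (j + 1)) a : Fin A) := by
      rw [f14, h14, pow_succ', Perm.mul_apply]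
    rw [den_seq, den_ifNe]
    have c1 : (var 16).eval s = ((σ ^ j) a : Fin A) := by simp [h16]
    have c2 : (var 8).eval s = (b : ℕ) := by simp [f8]
    rw [c1, c2]
    by_cases hb : (σ ^ j) a = b
    · rw [if_pos (by rw [hb])]
      refine ⟨by simp [Mem.put_apply, h16, e], .inl ⟨by simp [Mem.put_apply], ⟨j, by simpa using hb⟩⟩⟩
    · rw [if_neg (by rw [Int.ofNat_inj]; exact fun e => hb (Fin.ext e))]
      refine ⟨by simp [Mem.put_apply, h16, e], ?_⟩
      rcases h17 with h | ⟨h, hn⟩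
      · exact .inl ⟨by simp [Mem.put_apply, h.1], h.2⟩
      · refine .inr ⟨by simp [Mem.put_apply, h], ?_⟩
        rw [Nat.forall_lt_succ_right]
        exact ⟨hn, hb⟩


/-- Arcs with a common head can exchange successors without destroying adjacency, and doing so
across two cycles merges them. Cycles only grow, so pairs treated earlier stay together. -/
theorem merging_spec {A M : ℕ} (hM : 0 < M) {σ₀ : Perm (Fin A)} {tl ln : ℕ → ℤ} (m : Mem)
    (h4 : m 4 0 = M) (h5 : m 5 0 = A) (h12 : m 12 = tl) (h13 : m 13 = ln) (h14 : Holds m σ₀) :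
    ∃ σ : Perm (Fin A), Holds (merging.den m) σ ∧
      ((∀ x : Fin A, (M : ℤ) ∣ tl x + ln x - tl (σ₀ x)) →
        ∀ x : Fin A, (M : ℤ) ∣ tl x + ln x - tl (σ x)) ∧
      ∀ x y : Fin A, (M : ℤ) ∣ (tl x + ln x) - (tl y + ln y) → σ.SameCycle x y := by
  have hM' : (0 : ℤ) < M := by exact_mod_cast hM
  suffices H : ∃ σ : Perm (Fin A), Holds (merging.den m) σ ∧
      ((∀ x : Fin A, (M : ℤ) ∣ tl x + ln x - tl (σ₀ x)) →
        ∀ x : Fin A, (M : ℤ) ∣ tl x + ln x - tl (σ x)) ∧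
      ∀ x y : Fin A, (x : ℕ) < A → (M : ℤ) ∣ (tl x + ln x) - (tl y + ln y) → σ.SameCycle x y by
    obtain ⟨σ, h1, h2, h3⟩ := H
    exact ⟨σ, h1, h2, fun x y => h3 x y x.2⟩
  generalize hMat : (∀ x : Fin A, (M : ℤ) ∣ tl x + ln x - tl (σ₀ x)) = Mat
  refine den_iter_induction (by decide) A h5 (fun k s => ∃ σ : Perm (Fin A), Holds s σ ∧
      (Mat → ∀ x : Fin A, (M : ℤ) ∣ tl x + ln x - tl (σ x)) ∧
      ∀ x y : Fin A, (x : ℕ) < k → (M : ℤ) ∣ (tl x + ln x) - (tl y + ln y) → σ.SameCycle x y)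
      ⟨σ₀, fun x => by rw [Mem.put_ne _ _ _ (by decide)]; exact h14 x, by rw [← hMat]; exact id,
        by simp⟩ ?_
  rintro k hk s ⟨σ, hσ, hmat, hcyc⟩ h7 hfr
  have inner := den_iter_induction (v := 8) (h := 5) (m := s) (c := .seq search
    (.ite ((head (var 7) - head (var 8)).dvdInd + var 17 - 1) exchange .skip)) (by decide) A
    (by rw [hfr 5 (by decide), h5])
    (fun l s => ∃ σ : Perm (Fin A), Holds s σ ∧
      (Mat → ∀ x : Fin A, (M : ℤ) ∣ tl x + ln x - tl (σ x)) ∧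
      (∀ x y : Fin A, (x : ℕ) < k → (M : ℤ) ∣ (tl x + ln x) - (tl y + ln y) → σ.SameCycle x y) ∧
      ∀ y : Fin A, (y : ℕ) < l → (M : ℤ) ∣ (tl k + ln k) - (tl y + ln y) →
        σ.SameCycle ⟨k, hk⟩ y)
    ⟨σ, fun x => by rw [Mem.put_ne _ _ _ (by decide)]; exact hσ x, hmat, hcyc, by simp⟩ ?_
  · obtain ⟨σ', c1, c2, c3, c4⟩ := inner
    refine ⟨σ', fun x => by rw [Mem.put_ne _ _ _ (by decide)]; exact c1 x, c2, fun x y hx hd => ?_⟩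
    rcases Nat.lt_succ_iff_lt_or_eq.1 hx with hx | hx
    · exact c3 x y hx hd
    · have hx' : x = ⟨k, hk⟩ := Fin.ext hx
      subst hx'
      exact c4 y y.2 hd
  · rintro l hl s' ⟨σ', c1, c2, c3, c4⟩ h8 hfr'
    have f7 : s' 7 0 = k := by rw [hfr' 7 (by decide), h7]
    have f5 : s' 5 0 = A := by rw [hfr' 5 (by decide), hfr 5 (by decide), h5]
    suffices H : ∃ σ : Perm (Fin A), Holds ((LProg.seq search
        (.ite ((head (var 7) - head (var 8)).dvdInd + var 17 - 1) exchange .skip)).den s') σ ∧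
        (Mat → ∀ x : Fin A, (M : ℤ) ∣ tl x + ln x - tl (σ x)) ∧
        (∀ x y, σ'.SameCycle x y → σ.SameCycle x y) ∧
        ((M : ℤ) ∣ (tl k + ln k) - (tl l + ln l) → σ.SameCycle ⟨k, hk⟩ ⟨l, hl⟩) by
      obtain ⟨τ, d1, d2, d3, d4⟩ := H
      refine ⟨τ, fun x => by rw [Mem.put_ne _ _ _ (by decide)]; exact d1 x, d2,
        fun x y hx hd => d3 x y (c3 x y hx hd), fun y hy hd => ?_⟩
      rcases Nat.lt_succ_iff_lt_or_eq.1 hy with hy | hy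
      · exact d3 _ _ (c4 y hy hd)
      · have hy' : y = ⟨l, hl⟩ := Fin.ext hy
        subst hy'
        exact d4 hd
    have hflag := search_spec f5 c1 (a := ⟨k, hk⟩) (b := ⟨l, hl⟩) f7 h8
    rw [den_seq]
    set s₁ := search.den s' with hs₁
    have g : ∀ a, a ∉ search.writes → s₁ a = s' a := fun a ha => den_frame _ _ ha
    have g4 : s₁ 4 0 = M := by
      rw [g 4 (by decide), hfr' 4 (by decide), hfr 4 (by decide), h4]
    have g12 : s₁ 12 = tl := by
      rw [g 12 (by decide), hfr' 12 (by decide), hfr 12 (by decide), h12]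
    have g13 : s₁ 13 = ln := by
      rw [g 13 (by decide), hfr' 13 (by decide), hfr 13 (by decide), h13]
    have g7 : s₁ 7 0 = k := by rw [g 7 (by decide), f7]
    have g8 : s₁ 8 0 = l := by rw [g 8 (by decide), h8]
    have g14 : Holds s₁ σ' := fun x => by rw [g 14 (by decide)]; exact c1 x
    have b : ((head (var 7) - head (var 8)).dvdInd + var 17 - 1).eval s₁ =
        dvdInd M ((tl k + ln k) - (tl l + ln l)) + s₁ 17 0 - 1 := by
      simp [head, g4, g7, g8, g12, g13]
    rw [den_ite, b, dvdInd_eq hM']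
    -- The tested value is positive exactly when both indicators are one: the heads agree and the
    -- cycles differ.
    by_cases hsw : (M : ℤ) ∣ (tl k + ln k) - (tl l + ln l) ∧ ¬ σ'.SameCycle ⟨k, hk⟩ ⟨l, hl⟩
    · have h17 : s₁ 17 0 = 1 := by tauto
      rw [if_pos hsw.1, h17, if_pos (by norm_num)]
      refine ⟨_, exchange_spec g14 (a := ⟨k, hk⟩) (b := ⟨l, hl⟩) g7 g8, fun hm x => ?_,
        fun x y hxy => sameCycle_mul_swap hsw.2 hxy, fun _ => sameCycle_mul_swap_self hsw.2⟩
      have hk' := c2 hm ⟨k, hk⟩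
      have hl' := c2 hm ⟨l, hl⟩
      obtain ⟨u, hu⟩ := hsw.1
      rw [Perm.mul_apply]
      by_cases hxl : x = ⟨l, hl⟩
      · obtain ⟨v, hv⟩ := hk'
        rw [hxl, swap_apply_right]
        exact ⟨v - u, by rw [mul_sub, ← hv, ← hu]; ring⟩
      by_cases hxk : x = ⟨k, hk⟩
      · obtain ⟨v, hv⟩ := hl'
        rw [hxk, swap_apply_left]
        exact ⟨v + u, by rw [mul_add, ← hv, ← hu]; ring⟩
      rw [swap_apply_of_ne_of_ne hxk hxl]
      exact c2 hm x
    · rw [if_neg (by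
        rcases hflag with ⟨h, -⟩ | ⟨h, hn⟩
        · rw [h]; split_ifs <;> norm_num
        · rw [h, if_neg (fun hd => hsw ⟨hd, hn⟩)]; norm_num)]
      exact ⟨σ', g14, c2, fun x y h => h, fun hd => by tauto⟩

/-- The walk freezes at its first visit to `i`, so variable `17` then holds the position of the tail
of `i`. Without a visit it makes all `A` steps. -/
theorem walk_spec {A : ℕ} {σ : Perm (Fin A)} {m : Mem} {tl ln : ℕ → ℤ} (hA : 0 < A)
    (h5 : m 5 0 = A) (h12 : m 12 = tl) (h13 : m 13 = ln) (h14 : Holds m σ) {i : Fin A}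
    (h7 : m 7 0 = (i : ℕ)) :
    ∃ k ≤ A, walk.den m 16 0 = ((σ ^ k) ⟨0, hA⟩ : Fin A) ∧
      walk.den m 17 0 = walkPos tl ln σ ⟨0, hA⟩ k ∧ (∀ l < k, (σ ^ l) ⟨0, hA⟩ ≠ i) ∧
      ((σ ^ k) ⟨0, hA⟩ = i ∨ k = A) := by
  refine den_iter_induction (v := 9) (h := 5) (m := (set 17 (cell 12 0)).den ((set 16 0).den m))
    (c := ifNe (var 16) (var 7) (.seq (set 17 (var 17 + cell 13 (var 16)))
      (set 16 (cell 14 (var 16)))) .skip) (by decide) A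
    (by rw [den_frame _ _ (by decide), den_frame _ _ (by decide), h5])
    (fun j s => ∃ k ≤ j, s 16 0 = ((σ ^ k) ⟨0, hA⟩ : Fin A) ∧
      s 17 0 = walkPos tl ln σ ⟨0, hA⟩ k ∧ (∀ l < k, (σ ^ l) ⟨0, hA⟩ ≠ i) ∧
      ((σ ^ k) ⟨0, hA⟩ = i ∨ k = j)) ?_ ?_
  · refine ⟨0, le_rfl, by simp [Mem.put_apply], ?_, by simp, .inr rfl⟩
    simp [Mem.put_apply, walkPos, h12]
  · rintro j hj s ⟨k, hk, h16, h17, hn, hor⟩ h9 hfr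
    have fr : ∀ a, a ∉ [9, 16, 17] → s a = m a := by
      intro a ha
      simp only [List.mem_cons, List.not_mem_nil, or_false, not_or] at ha
      rw [hfr a (by simp [ifNe, writes, ha]), den_frame _ _ (by simp [writes, ha]),
        den_frame _ _ (by simp [writes, ha])]
    have c1 : (var 16).eval s = ((σ ^ k) ⟨0, hA⟩ : Fin A) := by simp [h16]
    have c2 : (var 7).eval s = (i : ℕ) := by simp [fr 7 (by decide), h7]
    rw [den_ifNe, c1, c2]
    by_cases hit : (σ ^ k) ⟨0, hA⟩ = i
    · rw [if_pos (by rw [hit])]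
      exact ⟨k, by omega, by simp [Mem.put_apply, h16], by simp [Mem.put_apply, h17], hn, .inl hit⟩
    · rw [if_neg (by rw [Int.ofNat_inj]; exact fun e => hit (Fin.ext e))]
      have hkj : k = j := by tauto
      subst hkj
      refine ⟨k + 1, le_rfl, ?_, ?_, ?_, .inr rfl⟩
      · have e : s 14 ((σ ^ k) ⟨0, hA⟩ : Fin A) = ((σ ^ (k + 1)) ⟨0, hA⟩ : Fin A) := by
          rw [fr 14 (by decide), h14, pow_succ', Perm.mul_apply]
        simp [Mem.put_apply, h16, e]
      · simp [Mem.put_apply, h16, h17, fr 13 (by decide), h13, walkPos, Finset.sum_range_succ,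
          add_assoc]
      · rw [Nat.forall_lt_succ_right]
        exact ⟨hn, hit⟩

/-- Arc `0` is the first task, so all tasks lie on one cycle exactly if each is reached from it. A
task that is not reached clears variable `6`, and nothing is claimed about its offset. -/
theorem offsets_spec {n A M : ℕ} {σ : Perm (Fin A)} {m : Mem} {tl ln : ℕ → ℤ} (hA : 0 < A)
    (hnA : n ≤ A) (h2 : m 2 0 = n) (h4 : m 4 0 = M) (h5 : m 5 0 = A) (h12 : m 12 = tl)
    (h13 : m 13 = ln) (h14 : Holds m σ) (h6 : m 6 0 = 0 ∨ m 6 0 = 1) :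
    (offsets.den m 6 0 = 0 ∨ offsets.den m 6 0 = 1) ∧
    (offsets.den m 6 0 = 1 ↔ m 6 0 = 1 ∧
      ∀ i (hi : i < n), σ.SameCycle ⟨0, hA⟩ ⟨i, by omega⟩) ∧
    ∀ i (hi : i < n), σ.SameCycle ⟨0, hA⟩ ⟨i, by omega⟩ → ∃ k, FirstHit σ ⟨0, hA⟩ ⟨i, by omega⟩ k ∧
      offsets.den m 1 (i + 1) = (walkPos tl ln σ ⟨0, hA⟩ k - tl i) / M := by
  suffices H : (offsets.den m 6 0 = 0 ∨ offsets.den m 6 0 = 1) ∧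
      (offsets.den m 6 0 = 1 ↔ m 6 0 = 1 ∧
        ∀ i (hi : i < A), i < n → σ.SameCycle ⟨0, hA⟩ ⟨i, hi⟩) ∧
      ∀ i (hi : i < A), i < n → σ.SameCycle ⟨0, hA⟩ ⟨i, hi⟩ → ∃ k, FirstHit σ ⟨0, hA⟩ ⟨i, hi⟩ k ∧
        offsets.den m 1 (i + 1) = (walkPos tl ln σ ⟨0, hA⟩ k - tl i) / M by
    obtain ⟨a1, a2, a3⟩ := H
    exact ⟨a1, a2.trans (and_congr_right fun _ =>
      ⟨fun h i hi => h i _ hi, fun h i _ hi => h i hi⟩), fun i hi => a3 i _ hi⟩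
  refine den_iter_induction (by decide) n h2 (fun j s => (s 6 0 = 0 ∨ s 6 0 = 1) ∧
      (s 6 0 = 1 ↔ m 6 0 = 1 ∧ ∀ i (hi : i < A), i < j → σ.SameCycle ⟨0, hA⟩ ⟨i, hi⟩) ∧
      ∀ i (hi : i < A), i < j → σ.SameCycle ⟨0, hA⟩ ⟨i, hi⟩ → ∃ k, FirstHit σ ⟨0, hA⟩ ⟨i, hi⟩ k ∧
        s 1 (i + 1) = (walkPos tl ln σ ⟨0, hA⟩ k - tl i) / M) ?_ ?_
  · simpa [Mem.put_apply] using h6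
  · rintro j hj s ⟨b1, b2, b3⟩ h7 hfr
    have hjA : j < A := by omega
    rw [den_seq, den_seq]
    obtain ⟨k, hk, w1, w2, w3, w4⟩ := walk_spec (m := s) (σ := σ) (tl := tl) (ln := ln) hA
      (by rw [hfr 5 (by decide), h5]) (by rw [hfr 12 (by decide), h12])
      (by rw [hfr 13 (by decide), h13]) (fun x => by rw [hfr 14 (by decide)]; exact h14 x)
      (i := ⟨j, hjA⟩) h7
    have fw : ∀ a, a ∉ walk.writes → walk.den s a = s a := fun a ha => den_frame _ _ ha
    have w7 : walk.den s 7 0 = j := by rw [fw 7 (by decide), h7]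
    have w4' : walk.den s 4 0 = M := by rw [fw 4 (by decide), hfr 4 (by decide), h4]
    have w12 : walk.den s 12 = tl := by rw [fw 12 (by decide), hfr 12 (by decide), h12]
    have w6 : walk.den s 6 = s 6 := fw 6 (by decide)
    have wo : walk.den s 1 = s 1 := fw 1 (by decide)
    generalize walk.den s = s₁ at *
    have c1 : (var 16).eval s₁ = ((σ ^ k) ⟨0, hA⟩ : Fin A) := by simp [w1]
    have c2 : (var 7).eval s₁ = (j : ℕ) := by simp [w7]
    rw [den_ifNe, c1, c2]
    -- A first hit takes fewer than `A` steps, so a walk that made all `A` steps without visiting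
    -- `j` shows that `j` is on another cycle.
    have hit_iff : (((σ ^ k) ⟨0, hA⟩ : Fin A) : ℤ) = (j : ℕ) ↔ σ.SameCycle ⟨0, hA⟩ ⟨j, hjA⟩ := by
      constructor
      · intro e
        exact ⟨k, Fin.ext (by simpa using e)⟩
      · intro hs
        obtain ⟨l, hl, hit⟩ := exists_firstHit hs
        rcases w4 with h | h
        · rw [h]
        · exact absurd hit.1 (w3 l (by omega))
    have old : ∀ (s₂ : Mem), s₂ 7 0 = j → s₂ 1 = s 1 → ∀ i (hi : i < A), i < j →
        σ.SameCycle ⟨0, hA⟩ ⟨i, hi⟩ → ∃ k, FirstHit σ ⟨0, hA⟩ ⟨i, hi⟩ k ∧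
        (((store 1 (var 7 + 1) ((var 17 - cell 12 (var 7)) / var 4)).den s₂).put 7 0 (j + 1)) 1
          (i + 1) = (walkPos tl ln σ ⟨0, hA⟩ k - tl i) / M := by
      intro s₂ e1 e2 i hi hij hs
      obtain ⟨k, hk, e⟩ := b3 i hi hij hs
      refine ⟨k, hk, ?_⟩
      have ej : ((j : ℤ) + 1).toNat = j + 1 := by omega
      simp [Mem.put_apply, e1, ej, hij.ne, e2, e]
    by_cases hs : σ.SameCycle ⟨0, hA⟩ ⟨j, hjA⟩
    · rw [if_pos (hit_iff.2 hs), den_skip]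
      refine ⟨?_, ?_, fun i hi hij hs' => ?_⟩
      · simpa [Mem.put_apply, w6] using b1
      · simp only [den_store, Mem.put_apply, w6]
        norm_num
        rw [b2]
        refine and_congr_right fun _ => ⟨fun h i hi hij => ?_, fun h i hi hij => h i hi (by omega)⟩
        rcases Nat.lt_or_eq_of_le hij with hij | rfl
        · exact h i hi hij
        · exact hs
      · rcases Nat.lt_succ_iff_lt_or_eq.1 hij with hij | rfl
        · exact old s₁ w7 wo i hi hij hs'
        · have hhit : (σ ^ k) ⟨0, hA⟩ = ⟨i, hjA⟩ :=
            Fin.ext (by simpa using hit_iff.2 hs)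
          refine ⟨k, ⟨hhit, w3⟩, ?_⟩
          have ej : ((i : ℤ) + 1).toNat = i + 1 := by omega
          simp [Mem.put_apply, w7, ej, w2, w12, w4']
    · rw [if_neg (fun h => hs (hit_iff.1 h))]
      refine ⟨?_, ?_, fun i hi hij hs' => ?_⟩
      · left; simp [Mem.put_apply]
      · simp only [den_store, Mem.put_apply]
        norm_num
        intro _
        exact ⟨j, le_rfl, hjA, hs⟩
      · rcases Nat.lt_succ_iff_lt_or_eq.1 hij with hij | rfl
        · exact old _ (by simp [Mem.put_apply, w7]) (by
            rw [den_frame _ _ (by decide), wo]) i hi hij hs'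
        · exact absurd hs' hs

end LProg

/-! ### Reading the encoding -/

theorem getD_flatten_four (l : List (List ℤ)) (hl : ∀ x ∈ l, x.length = 4) (i j : ℕ) (hj : j < 4) :
    l.flatten.getD (4 * i + j) 0 = (l.getD i []).getD j 0 := by
  induction l generalizing i with
  | nil => simp
  | cons x l ih =>
    have hx : x.length = 4 := hl x (by simp)
    rw [List.flatten_cons]
    cases i with
    | zero => rw [List.getD_append _ _ _ _ (by omega)]; simp
    | succ i =>
      rw [List.getD_append_right _ _ _ _ (by omega), hx,
        show 4 * (i + 1) + j - 4 = 4 * i + j by omega, ih (fun y hy => hl y (by simp [hy]))]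
      simp

namespace TaskInstance

variable (I : TaskInstance)

theorem length_encode : I.encode.length = 2 + 4 * I.n := by
  simp only [encode, List.length_cons, List.length_flatten, List.map_ofFn]
  have : (List.length ∘ fun i => [(I.s i).num, ((I.s i).den : ℤ), (I.e i).num, ((I.e i).den : ℤ)]) =
      fun _ => 4 := rfl
  rw [this]
  simp; omega

theorem encode_getD (i : Fin I.n) (j : ℕ) (hj : j < 4) : inputMem I.encode 0 (3 + 4 * i + j) =
    [(I.s i).num, ((I.s i).den : ℤ), (I.e i).num, ((I.e i).den : ℤ)].getD j 0 := by
  simp only [inputMem, encode, if_true]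
  rw [show 3 + 4 * (i : ℕ) + j = (4 * i + j) + 1 + 1 + 1 by omega, List.getD_cons_succ,
    List.getD_cons_succ, List.getD_cons_succ, getD_flatten_four _ (by simp) _ _ hj]
  congr 1
  rw [List.getD_eq_getElem _ _ (by simp)]
  simp

theorem input_num (u : ℕ) (hu : u < 2 * I.n) :
    inputMem I.encode 0 (3 + 2 * u) = (I.endpoint u).num := by
  have hi : u / 2 < I.n := by omega
  rcases Nat.mod_two_eq_zero_or_one u with h | h
  · have e := I.encode_getD ⟨u / 2, hi⟩ 0 (by omega)
    rw [show 3 + 4 * (u / 2) + 0 = 3 + 2 * u by omega] at e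
    simp [e, endpoint, hi, h]
  · have e := I.encode_getD ⟨u / 2, hi⟩ 2 (by omega)
    rw [show 3 + 4 * (u / 2) + 2 = 3 + 2 * u by omega] at e
    simp [e, endpoint, hi, h]

theorem input_den (u : ℕ) (hu : u < 2 * I.n) :
    inputMem I.encode 0 (4 + 2 * u) = (I.endpoint u).den := by
  have hi : u / 2 < I.n := by omega
  rcases Nat.mod_two_eq_zero_or_one u with h | h
  · have e := I.encode_getD ⟨u / 2, hi⟩ 1 (by omega)
    rw [show 3 + 4 * (u / 2) + 1 = 4 + 2 * u by omega] at e
    simp [e, endpoint, hi, h]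
  · have e := I.encode_getD ⟨u / 2, hi⟩ 3 (by omega)
    rw [show 3 + 4 * (u / 2) + 3 = 4 + 2 * u by omega] at e
    simp [e, endpoint, hi, h]

end TaskInstance

namespace LProg

open BalancedTasks.Expr
open Equiv

/-! ### Correctness of the main program -/

/-- The bound on the absolute values of the offsets. -/
def offsetBound (n : ℕ) : ℕ := 2 * n * (2 * n) + 4 * (2 * n)

/-- The final memory `m` describes the solution of the instance. -/
structure Solves (I : TaskInstance) (m : Mem) : Prop where
  n_eq : m 2 0 = I.n
  answer : m 6 0 = 0 ∨ m 6 0 = 1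
  valid : m 6 0 = 1 → I.Valid fun i => m 1 (i + 1)
  bound : m 6 0 = 1 → ∀ i < I.n, (m 1 (i + 1)).natAbs ≤ offsetBound I.n
  complete : (∃ f : I.Assignment, I.Feasible f ∧ I.Balanced f) → m 6 0 = 1

theorem easy_solves (I : TaskInstance) (hq : 2 * I.n ≤ I.q) (m : Mem) (h2 : m 2 0 = I.n) :
    Solves I (easy.den m) := by
  have hout : ∀ i < I.n, easy.den m 1 (i + 1) = 2 * i := by
    refine den_iter_induction (m := (set 6 1).den m) (by decide) I.n
      (by rw [den_frame _ _ (by decide), h2])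
      (fun k s => ∀ i < k, s 1 (i + 1) = 2 * i) (by simp) ?_
    intro k hk s hs h7 _ i hi
    have ek : ((k : ℤ) + 1).toNat = k + 1 := by omega
    rcases Nat.lt_succ_iff_lt_or_eq.1 hi with hi | rfl
    · simp [Mem.put_apply, h7, ek, hi.ne, hs i hi]
    · simp [Mem.put_apply, h7, ek]; ring
  have h6 : easy.den m 6 0 = 1 := by
    rw [easy, den_seq, den_frame _ _ (by decide)]; simp [Mem.put_apply]
  refine ⟨by rw [den_frame _ _ (by decide), h2], .inr h6, fun _ => ?_, fun _ i hi => ?_, fun _ => h6⟩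
  · intro i i' r r' hne ho
    simp only [hout i i.2, hout i' i'.2]
    exact I.valid_two_mul hq i i' r r' hne ho
  · rw [hout i hi, offsetBound]
    have : (2 * (i : ℤ)).natAbs = 2 * i := by omega
    rw [this]; omega

/-- The flag tests the two necessary conditions, load at most `q` and all tasks on the cycle of arc
`0`; after merging, adjacent arcs share a cycle, so the latter is connectivity. Conversely, these
conditions are what `IsArcs.not_dvd` needs. The bound `q < 2 n` also ensures `n > 0`, so that arc
`0` exists. -/
theorem hard_solves (I : TaskInstance) (hq : I.q < 2 * I.n) (m : Mem)
    (h0 : m 0 = inputMem I.encode 0) (h2 : m 2 0 = I.n)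
    (h3 : m 3 0 = I.q) (h4 : m 4 0 = (2 * I.n : ℕ)) (h5 : m 5 0 = (I.n + 2 * I.n * I.q : ℕ)) :
    Solves I (hard.den m) := by
  have hM : 0 < 2 * I.n := by omega
  have hM' : (0 : ℤ) < (2 * I.n : ℕ) := by exact_mod_cast hM
  have hA : 0 < I.n + 2 * I.n * I.q := by omega
  simp only [hard, den_seq]
  have p1 := ranks_spec I m h4 (by rw [h0]; exact I.input_num) (by rw [h0]; exact I.input_den)
  have f1 : ∀ a, a ∉ ranks.writes → ranks.den m a = m a := fun a ha => den_frame _ _ ha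
  generalize ranks.den m = m₁ at *
  have p2 := taskArcs_spec m₁ (by rw [f1 2 (by decide), h2]) p1
  have f2 : ∀ a, a ∉ taskArcs.writes → taskArcs.den m₁ a = m₁ a := fun a ha => den_frame _ _ ha
  generalize taskArcs.den m₁ = m₂ at *
  have p3 := idleArcs_spec (n := I.n) (q := I.q) (M := 2 * I.n) m₂
    (by rw [f2 2 (by decide), f1 2 (by decide), h2])
    (by rw [f2 3 (by decide), f1 3 (by decide), h3])
    (by rw [f2 4 (by decide), f1 4 (by decide), h4])
    (by rw [f2 11 (by decide)]; exact p1) p2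
  have f3 : ∀ a, a ∉ idleArcs.writes → idleArcs.den m₂ a = m₂ a := fun a ha => den_frame _ _ ha
  generalize idleArcs.den m₂ = m₃ at *
  obtain ⟨arcs, ok3, ok3'⟩ := p3
  change IsArcs I.n I.q (2 * I.n) I.start I.finish _ _ at arcs
  change m₃ 6 0 = 1 ↔ ∀ t < 2 * I.n, load I.n (2 * I.n : ℕ) I.start I.finish (t : ℕ) ≤ I.q at ok3'
  have load3 : m₃ 6 0 = 1 ↔ ∀ t, load I.n (2 * I.n : ℕ) I.start I.finish t ≤ I.q := by
    refine ok3'.trans ⟨fun h t => ?_, fun h t _ => h t⟩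
    have a1 := Int.emod_nonneg t hM'.ne'
    have a2 := Int.emod_lt_of_pos t hM'
    have a3 := h (t % (2 * I.n : ℕ)).toNat (by omega)
    rwa [Int.toNat_of_nonneg a1, periodic_emod (load_periodic hM' _ _)] at a3
  have g4 : m₃ 4 0 = (2 * I.n : ℕ) := by
    rw [f3 4 (by decide), f2 4 (by decide), f1 4 (by decide), h4]
  have g5 : m₃ 5 0 = (I.n + 2 * I.n * I.q : ℕ) := by
    rw [f3 5 (by decide), f2 5 (by decide), f1 5 (by decide), h5]
  have g2 : m₃ 2 0 = I.n := by rw [f3 2 (by decide), f2 2 (by decide), f1 2 (by decide), h2]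
  clear f1 f2 f3 ok3' p1 p2
  have p4 := identity_spec m₃ g5
  have f4 : ∀ a, a ∉ identity.writes → identity.den m₃ a = m₃ a := fun a ha => den_frame _ _ ha
  generalize identity.den m₃ = m₄ at *
  obtain ⟨σ₁, p5, p5'⟩ := matching_spec hM m₄ (by rw [f4 4 (by decide), g4])
    (by rw [f4 5 (by decide), g5]) (f4 12 (by decide)) (f4 13 (by decide)) p4
  have f5 : ∀ a, a ∉ matching.writes → matching.den m₄ a = m₄ a := fun a ha => den_frame _ _ ha
  generalize matching.den m₄ = m₅ at *
  obtain ⟨σ, p6, p6', p6''⟩ := merging_spec hM m₅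
    (by rw [f5 4 (by decide), f4 4 (by decide), g4])
    (by rw [f5 5 (by decide), f4 5 (by decide), g5])
    (by rw [f5 12 (by decide), f4 12 (by decide)]) (by rw [f5 13 (by decide), f4 13 (by decide)]) p5
  have f6 : ∀ a, a ∉ merging.writes → merging.den m₅ a = m₅ a := fun a ha => den_frame _ _ ha
  generalize merging.den m₅ = m₆ at *
  have e6 : m₆ 6 = m₃ 6 := by rw [f6 6 (by decide), f5 6 (by decide), f4 6 (by decide)]
  obtain ⟨p7, p7', p7''⟩ := offsets_spec (n := I.n) (M := 2 * I.n) (m := m₆) (σ := σ) hA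
    (Nat.le_add_right _ _)
    (by rw [f6 2 (by decide), f5 2 (by decide), f4 2 (by decide), g2])
    (by rw [f6 4 (by decide), f5 4 (by decide), f4 4 (by decide), g4])
    (by rw [f6 5 (by decide), f5 5 (by decide), f4 5 (by decide), g5])
    (by rw [f6 12 (by decide), f5 12 (by decide), f4 12 (by decide)])
    (by rw [f6 13 (by decide), f5 13 (by decide), f4 13 (by decide)]) p6 (by rw [e6]; exact ok3)
  have f7 : offsets.den m₆ 2 = m₃ 2 := by
    rw [den_frame _ _ (by decide), f6 2 (by decide), f5 2 (by decide), f4 2 (by decide)]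
  generalize offsets.den m₆ = m₇ at *
  rw [e6, load3] at p7'
  have load0 : ∀ t, 0 ≤ load I.n (2 * I.n : ℕ) I.start I.finish t := fun t =>
    Finset.sum_nonneg fun i hi => cov_nonneg hM' (I.start_lt_finish i (Finset.mem_range.1 hi))
  have matched : (∀ t, load I.n (2 * I.n : ℕ) I.start I.finish t ≤ I.q) →
      ∀ x : Fin (I.n + 2 * I.n * I.q), ((2 * I.n : ℕ) : ℤ) ∣ m₃ 12 x + m₃ 13 x - m₃ 12 (σ x) := by
    intro hl
    refine p6' (p5' fun v => ?_)
    rw [Fin.sum_univ_eq_sum_range (fun x => dvdInd _ (m₃ 12 x + m₃ 13 x - v)),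
      Fin.sum_univ_eq_sum_range (fun x => dvdInd _ (m₃ 12 x - v))]
    exact arcs.sum_head_eq_sum_tail hM load0 hl v
  refine ⟨by rw [f7, g2], p7, fun h1 => ?_, fun h1 i hi => ?_, ?_⟩
  · obtain ⟨hl, hc⟩ := p7'.1 h1
    have hK : ∀ i, ∃ k, ∀ hi : i < I.n, FirstHit σ ⟨0, hA⟩ ⟨i, by omega⟩ k ∧
        m₇ 1 (i + 1) = (walkPos (m₃ 12) (m₃ 13) σ ⟨0, hA⟩ k - m₃ 12 i) / (2 * I.n : ℕ) := by
      intro i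
      by_cases hi : i < I.n
      · obtain ⟨k, hk⟩ := p7'' i hi (hc i hi)
        exact ⟨k, fun _ => hk⟩
      · exact ⟨0, fun h => absurd h hi⟩
    choose K hK using hK
    intro i i' r r' hne ho
    obtain ⟨T, t1, t2, t3, t4⟩ := (I.overlap_iff_exists i i' r r').1 ho
    have := arcs.not_dvd hM I.start_lt_finish hl (matched hl) (o := ⟨0, hA⟩) (K := K)
      (fun i hi => (hK i hi).1) i.2 i'.2 (fun e => hne (Fin.ext e)) t1 t2 t3 t4
    simp only [(hK i i.2).2, (hK i' i'.2).2, arcs.tl_task i i.2, arcs.tl_task i' i'.2]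
    exact this
  · obtain ⟨hl, hc⟩ := p7'.1 h1
    obtain ⟨k, hk, e⟩ := p7'' i hi (hc i hi)
    have hsum : ∑ x : Fin (I.n + 2 * I.n * I.q), m₃ 13 x = I.q * (2 * I.n : ℕ) := by
      rw [Fin.sum_univ_eq_sum_range (fun a => m₃ 13 a), arcs.sum_ln hM load0 hl]
    have hln := arcs.ln_nonneg I.start_lt_finish
    have t0 : m₃ 12 0 = I.start 0 := arcs.tl_task 0 (by omega)
    have ti : m₃ 12 i = I.start i := arcs.tl_task i hi
    have s0 := I.abs_rank_endpoint_le (2 * 0)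
    have si := I.abs_rank_endpoint_le (2 * i)
    change |I.start 0| ≤ _ at s0
    change |I.start i| ≤ _ at si
    -- Up to a first hit the walk is no longer than all arcs together, `q * 2 n ≤ (2 n)²`. The two
    -- starts, at most `2 * (2 n)` in absolute value, account for the rest of `offsetBound`.
    have hpos : m₃ 12 0 ≤ walkPos (m₃ 12) (m₃ 13) σ ⟨0, hA⟩ k ∧
        walkPos (m₃ 12) (m₃ 13) σ ⟨0, hA⟩ k ≤ m₃ 12 0 + I.q * (2 * I.n : ℕ) := by
      have w0 : walkPos (m₃ 12) (m₃ 13) σ ⟨0, hA⟩ 0 = m₃ 12 0 := by simp [walkPos]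
      rcases Nat.eq_zero_or_pos k with rfl | hk0
      · rw [w0]; constructor
        · exact le_rfl
        · have : (0 : ℤ) ≤ I.q * (2 * I.n : ℕ) := by positivity
          omega
      · obtain ⟨b1, b2⟩ := walkPos_le (tl := m₃ 12) hln hk0 hk
        rw [hsum, w0] at b2
        rw [w0] at b1
        have := hln ((σ ^ 0) ⟨0, hA⟩)
        have := hln ⟨i, by omega⟩
        constructor <;> omega
    rw [e]
    refine (Int.natAbs_ediv_le_natAbs _ _).trans ?_
    have hq2 : (I.q : ℤ) * (2 * I.n : ℕ) ≤ (2 * I.n : ℕ) * (2 * I.n : ℕ) := by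
      exact_mod_cast Nat.mul_le_mul_right _ hq.le
    have hb : ((offsetBound I.n : ℕ) : ℤ) =
        (2 * I.n : ℕ) * (2 * I.n : ℕ) + 4 * (2 * I.n : ℕ) := by
      simp [offsetBound]
    rw [abs_le] at s0 si
    have : |walkPos (m₃ 12) (m₃ 13) σ ⟨0, hA⟩ k - m₃ 12 i| ≤ (offsetBound I.n : ℕ) := by
      rw [abs_le, hb]
      constructor <;> linarith [hpos.1, hpos.2, s0.1, s0.2, si.1, si.2]
    rw [Int.abs_eq_natAbs] at this
    exact_mod_cast this
  · rintro ⟨f, hf, hb⟩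
    have sch := I.schedule_of_balanced hf hb
    have hl := sch.load_le hM I.start_lt_finish I.finish_le (b := 2 * (2 * I.n : ℕ))
      (fun i _ => I.finish_le_bound i)
    refine p7'.2 ⟨hl, fun i hi => ?_⟩
    have hmat := matched hl
    have conn := sch.tasks_connected I.q_pos hM I.start_lt_finish I.finish_le arcs
      (b := 2 * (2 * I.n : ℕ)) (fun i _ => I.finish_le_bound i)
      -- Equality is included because the relation has to be reflexive on all natural numbers, not
      -- only on arcs.
      (fun x y => x = y ∨ ∃ hx hy, σ.SameCycle ⟨x, hx⟩ ⟨y, hy⟩) (fun _ => .inl rfl)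
      (by
        rintro x y z (rfl | ⟨hx, hy, h⟩) (rfl | ⟨hy', hz, h'⟩)
        · exact .inl rfl
        · exact .inr ⟨hy', hz, h'⟩
        · exact .inr ⟨hx, hy, h⟩
        · exact .inr ⟨hx, hz, h.trans h'⟩)
      (by
        intro x y hx hy hd
        refine .inr ⟨hx, hy, ?_⟩
        -- The predecessor of `y` under `σ` has the same head as `x`, namely the tail of `y`;
        -- merging has put arcs with a common head on one cycle.
        have h1 := hmat (σ.symm ⟨y, hy⟩)
        rw [Equiv.apply_symm_apply] at h1
        have h2 := p6'' ⟨x, hx⟩ (σ.symm ⟨y, hy⟩) (by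
          obtain ⟨u, hu⟩ := hd
          obtain ⟨v, hv⟩ := h1
          simp only at hu hv
          exact ⟨u - v, by rw [mul_sub, ← hu, ← hv]; ring⟩)
        rwa [Perm.sameCycle_symm_apply_right] at h2)
      ⟨0, by omega⟩ ⟨i, hi⟩
    rcases conn with h | ⟨_, _, h⟩
    · have : i = 0 := by simpa using h.symm
      subst this
      exact .refl _ _
    · exact h


/-- The memory after reading the parameters. -/
theorem setup_spec (I : TaskInstance) :
    let s := setup.den (inputMem I.encode)
    s 0 = inputMem I.encode 0 ∧ s 2 0 = I.n ∧ s 3 0 = I.q ∧ s 4 0 = (2 * I.n : ℕ) ∧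
      s 5 0 = (I.n + 2 * I.n * I.q : ℕ) := by
  have e1 : inputMem I.encode 0 1 = I.n := rfl
  have e2 : inputMem I.encode 0 2 = I.q := rfl
  have t1 : (1 : ℤ).toNat = 1 := rfl
  refine ⟨den_frame _ _ (by decide), ?_, ?_, ?_, ?_⟩
  · simp [setup, Mem.put_apply, t1, e1]
  · simp [setup, Mem.put_apply, e2]
  · simp [setup, Mem.put_apply, t1, e1]; ring
  · simp [setup, Mem.put_apply, t1, e1, e2, two_mul]

theorem many_workers_iff (I : TaskInstance) :
    0 < (var 3 + 1 - var 4).eval (setup.den (inputMem I.encode)) ↔ 2 * I.n ≤ I.q := by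
  obtain ⟨-, -, h3, h4, -⟩ := setup_spec I
  have : (var 3 + 1 - var 4).eval (setup.den (inputMem I.encode)) = I.q + 1 - (2 * I.n : ℕ) := by
    rw [eval_sub, eval_add, eval_cell, eval_cell, eval_const, Int.toNat_zero, eval_one, h3, h4]
  rw [this]; omega

theorem main_solves (I : TaskInstance) : Solves I (main.den (inputMem I.encode)) := by
  obtain ⟨h0, h2, h3, h4, h5⟩ := setup_spec I
  rw [main, den_seq, den_ite]
  split_ifs with h
  · exact easy_solves I ((many_workers_iff I).1 h) _ h2
  · exact hard_solves I (not_le.1 (fun e => h ((many_workers_iff I).2 e))) _ h0 h2 h3 h4 h5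

/-! ### Running times -/

/-- The bound on the number of steps of the main program. -/
def stepBound (D : ℕ) : ℕ := 5 + (easy.len + hard.len) * (8 * (D + 1) ^ 2) ^ hard.depth

/-- Loops over all `n + 2 n q` arcs occur only in the branch with `q < 2 n`, where this number is
quadratic in the input size. The other branch loops over the tasks only. -/
theorem main_steps_le (I : TaskInstance) :
    main.steps (inputMem I.encode) ≤ stepBound (dataSize I.encode) := by
  obtain ⟨-, h2, h3, h4, h5⟩ := setup_spec I
  have hn : I.n ≤ dataSize I.encode := by
    have := length_le_dataSize I.encode
    rw [I.length_encode] at this; omega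
  generalize dataSize I.encode = D at *
  have hs : main.steps (inputMem I.encode) = 4 + (1 + if 0 < (var 3 + 1 - var 4).eval
      (setup.den (inputMem I.encode)) then easy.steps (setup.den (inputMem I.encode))
      else hard.steps (setup.den (inputMem I.encode))) := rfl
  rw [hs, stepBound]
  split_ifs with h
  · have b := steps_le easy.writes I.n easy (setup.den (inputMem I.encode)) (fun _ h => h) (by
      intro x hx
      have : x = 2 ∧ x ∉ easy.writes := by revert x; decide
      exact ⟨this.2, by rw [this.1, h2]; simp⟩)
    have b1 : (I.n + 1) ^ easy.depth ≤ (8 * (D + 1) ^ 2) ^ hard.depth :=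
      (Nat.pow_le_pow_left (by nlinarith) _).trans
        (Nat.pow_le_pow_right (by positivity) (by decide))
    have b2 : easy.len * (I.n + 1) ^ easy.depth ≤
        (easy.len + hard.len) * (8 * (D + 1) ^ 2) ^ hard.depth :=
      Nat.mul_le_mul (Nat.le_add_right _ _) b1
    omega
  · have hq : I.q < 2 * I.n := not_le.1 (fun e => h ((many_workers_iff I).2 e))
    have b := steps_le hard.writes (I.n + 2 * I.n * I.q + 2 * I.n) hard
      (setup.den (inputMem I.encode)) (fun _ h => h) (by
      intro x hx
      have : (x = 2 ∨ x = 3 ∨ x = 4 ∨ x = 5) ∧ x ∉ hard.writes := by revert x; decide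
      refine ⟨this.2, ?_⟩
      rcases this.1 with rfl | rfl | rfl | rfl
      · rw [h2, Int.toNat_natCast]; omega
      · rw [h3, Int.toNat_natCast]; omega
      · rw [h4, Int.toNat_natCast]; omega
      · rw [h5, Int.toNat_natCast]; omega)
    have hR : I.n + 2 * I.n * I.q + 2 * I.n + 1 ≤ 8 * (D + 1) ^ 2 := by
      have : 2 * I.n * I.q ≤ 2 * D * (2 * D) := Nat.mul_le_mul (by omega) (by omega)
      nlinarith
    have b1 := Nat.pow_le_pow_left hR hard.depth
    have b2 := Nat.mul_le_mul (Nat.le_add_left hard.len easy.len) b1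
    omega

open Polynomial in
/-- The bound on the running time of a program with weight `w` that consists of the main program
and at most two more steps. -/
noncomputable def timeBound (w : ℕ) : ℕ[X] :=
  C ((w + 1) ^ 2) *
    (9 + C (easy.len + hard.len) * (8 * (X + 1) ^ 2) ^ hard.depth + X) ^ 2

/-- The `9` in `timeBound` is the `5` of `stepBound`, two steps for writing the output, and the `2`
from `exec_inputMem`. -/
theorem eval_timeBound (w D : ℕ) :
    (timeBound w).eval D = (w + 1) ^ 2 * (stepBound D + 2 + D + 2) ^ 2 := by
  simp only [timeBound, stepBound, Polynomial.eval_mul, Polynomial.eval_pow, Polynomial.eval_add,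
    Polynomial.eval_C, Polynomial.eval_X, Polynomial.eval_ofNat, Polynomial.eval_one]
  ring

theorem computesWithin_of_steps {c : LProg} (hc : c.wf) (I : TaskInstance) {y : List ℤ}
    (hs : c.steps (inputMem I.encode) ≤ main.steps (inputMem I.encode) + 2)
    (hy : IsOutput (c.den (inputMem I.encode)) y) :
    ComputesWithin c.compile I.encode y ((timeBound c.weight).eval (dataSize I.encode)) := by
  obtain ⟨t, ht, hx⟩ := c.exec_inputMem hc I.encode
  refine ⟨t, ht.trans ?_, _, hx, hy⟩
  rw [eval_timeBound]
  have := main_steps_le I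
  gcongr
  omega

/-! ### The three algorithms -/

theorem decider_steps (m : Mem) : decider.steps m = main.steps m + 2 := by
  rw [decider, steps, steps, steps, steps]

theorem solver_steps (m : Mem) : solver.steps m = main.steps m + 1 := by
  rw [solver, steps, steps]

theorem decider_output (I : TaskInstance) :
    IsOutput (decider.den (inputMem I.encode)) [main.den (inputMem I.encode) 6 0] := by
  intro k hk
  simp only [List.length_singleton] at hk
  have t1 : (1 : ℤ).toNat = 1 := rfl
  interval_cases k <;> simp [decider, Mem.put_apply, t1]

theorem solver_output (I : TaskInstance) : IsOutput (solver.den (inputMem I.encode))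
    (List.ofFn fun i : Fin I.n => main.den (inputMem I.encode) 1 (i + 1)) := by
  have h2 := (main_solves I).n_eq
  intro k hk
  rw [List.length_ofFn] at hk ⊢
  simp only [solver, den_seq, den_store, eval_zero, Int.toNat_zero, Mem.put_apply, eval_cell,
    eval_const, h2, true_and]
  cases k with
  | zero => simp
  | succ k =>
    rw [if_neg (by omega), List.getD_cons_succ, List.getD_eq_getElem _ _ (by simpa using hk)]
    simp

/-- The remainder is computed as `x - q * (x / q)` with `x = d[i] - r`. The description starts at
cell `4`, after the length of the input, `q`, `i` and `r`. -/
theorem evaluator_output (q i r : ℕ) (d : List ℤ) (hi : i < d.length) :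
    IsOutput (evaluator.den (inputMem ((q : ℤ) :: (i : ℤ) :: (r : ℤ) :: d)))
      [(d[i] - r) % q] := by
  set m := inputMem ((q : ℤ) :: (i : ℤ) :: (r : ℤ) :: d) with hm
  have e1 : m 0 1 = q := rfl
  have e2 : m 0 2 = i := rfl
  have e3 : m 0 3 = r := rfl
  have e4 : m 0 (4 + i) = d[i] := by
    simp only [hm, inputMem, if_true]
    rw [show 4 + i = i + 1 + 1 + 1 + 1 by omega, List.getD_cons_succ, List.getD_cons_succ,
      List.getD_cons_succ, List.getD_cons_succ, List.getD_eq_getElem _ _ hi]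
  have t1 : (1 : ℤ).toNat = 1 := rfl
  have t2 : (1 + 1 : ℤ).toNat = 2 := rfl
  have t3 : (1 + 1 + 1 : ℤ).toNat = 3 := rfl
  have t4 : (1 + 1 + 1 + 1 + (i : ℤ)).toNat = 4 + i := by omega
  intro k hk
  simp only [List.length_singleton] at hk
  simp only [evaluator, den_seq, den_store, eval_one, eval_zero, t1, Int.toNat_zero, Mem.put_apply,
    eval_sub, eval_mul, eval_div, eval_cell, eval_add, t2, t3, e1, e2, e3, t4, e4]
  interval_cases k
  · simp
  · simp [Int.emod_def]

open Polynomial in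
theorem describes_evaluator (I : TaskInstance) (c : ℕ → ℤ) :
    I.Describes evaluator.compile (C ((evaluator.weight + 1) ^ 2) * (X + 4) ^ 2)
      (List.ofFn fun i : Fin I.n => c i) (I.cyclic c) := by
  intro i r x
  obtain ⟨t, ht, hx⟩ := evaluator.exec_inputMem evaluator_wf x
  refine ⟨t, ht.trans (le_of_eq ?_), _, hx, ?_⟩
  · have : evaluator.steps (inputMem x) = 2 := rfl
    rw [this]
    simp only [Polynomial.eval_mul, Polynomial.eval_pow, Polynomial.eval_add, Polynomial.eval_C,
      Polynomial.eval_X, Polynomial.eval_ofNat]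
    ring
  · have := evaluator_output I.q i r (List.ofFn fun i : Fin I.n => c i) (by simp)
    rw [TaskInstance.cyclic_coe]
    simpa using this

theorem dataSize_ofFn_le {n b : ℕ} {c : ℕ → ℤ} (h : ∀ i < n, (c i).natAbs ≤ b) :
    dataSize (List.ofFn fun i : Fin n => c i) ≤ n * (1 + b) := by
  rw [dataSize, List.map_ofFn, List.sum_ofFn]
  refine (Finset.sum_le_card_nsmul _ _ (1 + b) fun i _ => ?_).trans (by simp)
  exact Nat.add_le_add_left ((size_le_self _).trans (h i i.2)) 1

end LProg
end BalancedTasks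

/-! ### The theorem -/

open BalancedTasks
theorem theorem1p2 :
    DecidableInPolyTime TaskInstance.encode
      (fun I : TaskInstance => ∃ f : I.Assignment, I.Feasible f ∧ I.Balanced f) ∧
    ∃ (P E : Prog) (T T' S : Polynomial ℕ), ∀ I : TaskInstance,
      (∃ f : I.Assignment, I.Feasible f ∧ I.Balanced f) →
      ∃ (d : List ℤ) (g : I.Assignment),
        ComputesWithin P I.encode d (T.eval (dataSize I.encode)) ∧
        dataSize d ≤ S.eval I.n ∧
        I.Describes E T' d g ∧
        I.Feasible g ∧ I.Balanced g ∧ I.HasPeriod g ⟨I.q, I.q_pos⟩ := by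
  refine ⟨⟨LProg.decider.compile, LProg.timeBound LProg.decider.weight, fun I => ?_⟩,
    LProg.solver.compile, LProg.evaluator.compile, LProg.timeBound LProg.solver.weight,
    .C ((LProg.evaluator.weight + 1) ^ 2) * (.X + 4) ^ 2,
    -- This is `n * (1 + offsetBound n)`: there are `n` offsets, and the number of binary digits of
    -- each is crudely bounded by its absolute value.
    .X * (1 + (2 * .X * (2 * .X) + 4 * (2 * .X))), fun I hI => ?_⟩
  · have sol := LProg.main_solves I
    have out := LProg.decider_output I
    have run : ∀ y : List ℤ, IsOutput (LProg.decider.den (inputMem I.encode)) y →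
        ComputesWithin LProg.decider.compile I.encode y
          ((LProg.timeBound LProg.decider.weight).eval (dataSize I.encode)) := fun y hy =>
      LProg.computesWithin_of_steps LProg.decider_wf I (LProg.decider_steps _).le hy
    refine ⟨fun h => run _ (by rw [sol.complete h] at out; exact out), fun h => run _ ?_⟩
    have h0 : LProg.main.den (inputMem I.encode) 6 0 = 0 :=
      sol.answer.resolve_right fun h1 => h (I.exists_balanced_of_valid (sol.valid h1))
    rw [h0] at out
    exact out
  · have sol := LProg.main_solves I
    have out := LProg.solver_output I
    generalize LProg.main.den (inputMem I.encode) = m at sol out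
    have h1 := sol.complete hI
    refine ⟨List.ofFn fun i : Fin I.n => m 1 (i + 1), I.cyclic fun i => m 1 (i + 1),
      LProg.computesWithin_of_steps LProg.solver_wf I
        ((LProg.solver_steps _).le.trans (Nat.le_succ _)) out, ?_,
      LProg.describes_evaluator I fun i => m 1 (i + 1), (sol.valid h1).feasible,
      I.cyclic_balanced _, I.cyclic_hasPeriod _⟩
    have := LProg.dataSize_ofFn_le (c := fun i => m 1 (i + 1)) (sol.bound h1)
    simpa [LProg.offsetBound] using this
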